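/- Let $G$ be a simple, locally finite graph (no loops, undirected) with countable vertex set $V$, let $q\colon V\to[0,\infty)$, and let $k$ be a real number such that $G$ is $k$-sparse, i.e. for every finite $W\subseteq V$ the induced subgraph has at most $\tfrac{k}{2}|W|$ (non-oriented) edges. On the complex Hilbert space $\ell^2(V)$ let $\Delta+q$ be the operator $$(\Delta+q)\varphi(v)=\sum_{w\sim v}\bigl(\varphi(v)-\varphi(w)\bigr)+q(v)\varphi(v)$$ with domain the set of all $\varphi\in\ell^2(V)$ for which the right-hand side lies in $\ell^2(V)$, and let $\deg+q$ be the operator of multiplication by the function $v\mapsto\deg(v)+q(v)$, with domain the set of all $\varphi\in\ell^2(V)$ with $(\deg+q)\varphi\in\ell^2(V)$. Both operators are selfadjoint and non-negative. Then: (a) For all $0<\varepsilon\le 1$ and all finitely supported $f\colon V\to\mathbb C$, $$(1-\varepsilon)\langle f,(\deg+q)f\rangle-\frac k2\Bigl(\frac1\varepsilon-\varepsilon\Bigr)\|f\|^2\le\langle f,(\Delta+q)f\rangle\le(1+\varepsilon)\langle f,(\deg+q)f\rangle+\frac k2\Bigl(\frac1\varepsilon-\varepsilon\Bigr)\|f\|^2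 .$$ (b) The form domains coincide: $\mathcal D\bigl((\Delta+q)^{1/2}\bigr)=\mathcal D\bigl((\deg+q)^{1/2}\bigr)$, where $T^{1/2}$ denotes the non-negative selfadjoint square root of $T$. (c) The operator $\Delta+q$ has purely discrete spectrum (i.e. empty essential spectrum) if and only if $$\liminf_{|x|\to\infty}(\deg+q)(x):=\sup_{W\subseteq V\text{ finite}}\ \inf_{x\in V\setminus W}(\deg+q)(x)=\infty .$$ In this case, if $V$ is infinite, the eigenvalues below the essential spectrum of both $\Delta+q$ and $\deg+q$, listed in increasing order and counted with multiplicity, form infinite sequences $\lambda_n(\Delta+q)$ and $\lambda_n(\deg+q)$, $n\ge0$, and $$\lim_{n\to\infty}\frac{\lambda_n(\Delta+q)}{\lambda_n(\deg+q)}=1 .$$ -/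

import Mathlib

noncomputable section

namespace SparseGraph

/-! ### Unbounded operators on a complex Hilbert space -/

section Operators

variable {H : Type*} [NormedAddCommGroup H] [InnerProductSpace ℂ H]

/-- `z` lies in the resolvent set of `T` if `T - z : D(T) → H` has a bounded everywhere defined
two-sided inverse. -/
def resolventSet (T : H →ₗ.[ℂ] H) : Set ℂ :=
  {z | ∃ R : H →L[ℂ] H,
      (∀ y : H, ∃ h : R y ∈ T.domain, T ⟨R y, h⟩ - z • R y = y) ∧
      ∀ x : T.domain, R (T x - z • (x : H)) = x}

/-- The spectrum of an (unbounded) operator. -/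
def spectrumOf (T : H →ₗ.[ℂ] H) : Set ℂ := (resolventSet T)ᶜ

/-- The eigenspace `ker (T - z)`, as a subspace of the domain of `T`. -/
def eigenspaceOf (T : H →ₗ.[ℂ] H) (z : ℂ) : Submodule ℂ T.domain :=
  LinearMap.ker (T.toFun - z • T.domain.subtype)

/-- The discrete spectrum: eigenvalues of finite multiplicity that are isolated points of the
spectrum. -/
def discreteSpectrum (T : H →ₗ.[ℂ] H) : Set ℂ :=
  {z | z ∈ spectrumOf T ∧ (∃ r : ℝ, 0 < r ∧ ∀ w ∈ spectrumOf T, dist w z < r → w = z) ∧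
      eigenspaceOf T z ≠ ⊥ ∧ FiniteDimensional ℂ (eigenspaceOf T z)}

/-- The essential spectrum: the complement of the discrete spectrum in the spectrum. -/
def essSpectrum (T : H →ₗ.[ℂ] H) : Set ℂ := spectrumOf T \ discreteSpectrum T

/-- The spectrum of `T` is purely discrete. -/
def HasPurelyDiscreteSpectrum (T : H →ₗ.[ℂ] H) : Prop := essSpectrum T = ∅

/-- A real number strictly below the essential spectrum (the essential spectrum of a selfadjoint
operator is a set of real numbers). -/
def BelowEssSpectrum (T : H →ₗ.[ℂ] H) (μ : ℝ) : Prop := ∀ z ∈ essSpectrum T, μ < z.re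

/-- `lam 0 ≤ lam 1 ≤ ⋯` is the infinite list of all eigenvalues of `T` below its essential
spectrum, in increasing order and counted with multiplicity. -/
def IsEigenvalueSequence (T : H →ₗ.[ℂ] H) (lam : ℕ → ℝ) : Prop :=
  Monotone lam ∧ (∀ n, BelowEssSpectrum T (lam n)) ∧
    ∀ μ : ℝ, BelowEssSpectrum T μ →
      {n | lam n = μ}.encard = Cardinal.toENat (Module.rank ℂ (eigenspaceOf T (μ : ℂ)))

/-- `S = T ^ (1/2)`: `S` is selfadjoint and non-negative, and `S ∘ S = T`, domains included. -/
def IsNonnegSqrt [CompleteSpace H] (S T : H →ₗ.[ℂ] H) : Prop :=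
  IsSelfAdjoint S ∧ (∀ x : S.domain, 0 ≤ (inner ℂ (x : H) (S x)).re) ∧
    ∀ x z : H, (x, z) ∈ T.graph ↔ ∃ y : H, (x, y) ∈ S.graph ∧ (y, z) ∈ S.graph

end Operators

/-! ### Operators on `ℓ²(V)` and sparse graphs -/

section Graphs

variable {V : Type*}

/-- The complex Hilbert space `ℓ²(V)`. -/
abbrev L2 (V : Type*) : Type _ := lp (fun _ : V => ℂ) 2

/-- The maximal domain `{φ ∈ ℓ²(V) | L φ ∈ ℓ²(V)}` of a linear map `L` on functions. -/
def maximalDomain (L : (V → ℂ) →ₗ[ℂ] (V → ℂ)) : Submodule ℂ (L2 V) where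
  carrier := {φ | Memℓp (L (φ : V → ℂ)) 2}
  add_mem' := by
    intro a b ha hb
    change Memℓp (L (a : V → ℂ)) 2 at ha
    change Memℓp (L (b : V → ℂ)) 2 at hb
    change Memℓp (L ((a + b : L2 V) : V → ℂ)) 2
    rw [lp.coeFn_add, map_add]
    exact ha.add hb
  zero_mem' := by
    change Memℓp (L ((0 : L2 V) : V → ℂ)) 2
    rw [lp.coeFn_zero, map_zero]
    exact zero_memℓp
  smul_mem' := by
    intro c a ha
    change Memℓp (L (a : V → ℂ)) 2 at ha
    change Memℓp (L ((c • a : L2 V) : V → ℂ)) 2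
    rw [lp.coeFn_smul, map_smul]
    exact ha.const_smul c

/-- The operator `φ ↦ L φ` on `ℓ²(V)` with its maximal domain. -/
def maximalOperator (L : (V → ℂ) →ₗ[ℂ] (V → ℂ)) : L2 V →ₗ.[ℂ] L2 V where
  domain := maximalDomain L
  toFun :=
    { toFun := fun φ => ⟨L ((φ : L2 V) : V → ℂ), φ.2⟩
      map_add' := by
        intro a b
        apply Subtype.ext
        change L (((a : L2 V) + (b : L2 V) : L2 V) : V → ℂ) = _
        rw [lp.coeFn_add, map_add]
        rfl
      map_smul' := by
        intro c a
        apply Subtype.ext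
        change L ((c • (a : L2 V) : L2 V) : V → ℂ) = _
        rw [lp.coeFn_smul, map_smul]
        rfl }

/-- The operator of multiplication by `g` on `ℓ²(V)`. -/
def mulOperator (g : V → ℝ) : L2 V →ₗ.[ℂ] L2 V :=
  maximalOperator
    { toFun := fun φ v => (g v : ℂ) * φ v
      map_add' := by intro a b; funext v; simp [mul_add]
      map_smul' := by intro c a; funext v; simp [mul_left_comm] }

variable (G : SimpleGraph V)

/-- The Schrödinger operator `Δ + q` on `ℓ²(V)`. -/
def schrodinger [G.LocallyFinite] (q : V → ℝ) : L2 V →ₗ.[ℂ] L2 V :=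
  maximalOperator
    { toFun := fun φ v => ∑ w ∈ G.neighborFinset v, (φ v - φ w) + (q v : ℂ) * φ v
      map_add' := by
        intro a b; funext v
        simp only [Pi.add_apply, add_sub_add_comm, Finset.sum_add_distrib]
        ring
      map_smul' := by
        intro c a; funext v
        simp only [Pi.smul_apply, smul_eq_mul, RingHom.id_apply, ← mul_sub, ← Finset.mul_sum]
        ring }

/-- The function `deg + q`. -/
def degPlus [G.LocallyFinite] (q : V → ℝ) : V → ℝ := fun v => (G.degree v : ℝ) + q v

/-- The number of non-oriented edges of the subgraph induced by `W`. -/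
def inducedEdgeCount (W : Finset V) : ℝ :=
  (1 / 2 : ℝ) * ({p : V × V | p.1 ∈ W ∧ p.2 ∈ W ∧ G.Adj p.1 p.2}.ncard : ℝ)

/-- `k`-sparse graphs. -/
def IsSparse (k : ℝ) : Prop :=
  ∀ W : Finset V, 2 * inducedEdgeCount G W ≤ k * (W.card : ℝ)

/-- `liminf_{|x| → ∞} g x`, the supremum over finite `W` of the infimum of `g` off `W`. -/
def liminfAtInfinity (g : V → ℝ) : EReal :=
  ⨆ W : Finset V, ⨅ x : {x : V // x ∉ W}, ((g x : ℝ) : EReal)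

/-- The value `⟨f, T f⟩` of the quadratic form of an operator (for a symmetric `T` this number is
real). -/
def quadForm (T : L2 V →ₗ.[ℂ] L2 V) (f : T.domain) : ℝ := (inner ℂ (f : L2 V) (T f)).re

end Graphs

end SparseGraph

end

/-!
The comparison of the forms of `Δ + q` and `deg + q` on finitely supported functions rests on one
elementary fact: in a `k`-sparse graph, the sum of `min (g v) (g w)` over ordered pairs of adjacent
vertices is at most `k ∑ g v` (`IsSparse.sum_min_le`, a discrete layer cake estimate). Applied to
`g = |f| ^ 2`, together with `2ab ≤ (1/ε - ε) min (a ^ 2) (b ^ 2) + ε (a ^ 2 + b ^ 2)`, it bounds the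
off-diagonal part of the form (`IsSparse.abs_form_sub_le`).

The finitely supported functions form a core of `Δ + q`. By local finiteness `Δ + q` is the adjoint
of its restriction to them, and the maximum principle shows that `Δ + q + 1` is injective on
`ℓ²(V)`; hence it maps the core onto a dense subspace (`IsGraphCore`, `IsSparse.isGraphCore`). So
`R = (Δ + q + 1)⁻¹` is a bounded operator with `0 ≤ R ≤ 1` (`IsGraphCore.exists_resolvent`), and
`√(1 - R) (√R)⁻¹` is the square root of `Δ + q`
(`IsNegOneResolvent.exists_isNonnegSqrt`). A core of an operator is also a core of each of its
non-negative square roots, so that the form comparison makes the form domains agree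
(`IsGraphCore.sqrt_domain_le`). Multiplication operators are covered as Schrödinger operators on the
graph without edges.

The spectrum of `Δ + q` is purely discrete if and only if `R` is compact: in one direction `R` is
approximated by finite rank functions of `R` (`IsNegOneResolvent.isCompactOperator`), in the other
`Δ + q` is diagonal in a Hilbert basis, with eigenvalues tending to infinity
(`IsNegOneResolvent.exists_isDiagonal`, `IsDiagonal.hasPurelyDiscreteSpectrum`). Compactness of `R`
is equivalent to `deg + q → ∞` (`finite_degPlus_le_of_compact`,
`IsSparse.isCompactOperator_resolvent`). Finally, testing each form on the span of the first
eigenvectors of the other operator gives, with `C = k/2 (1/ε - ε)`,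
`(1 - ε) λₙ(deg + q) - C ≤ λₙ(Δ + q) ≤ (1 + ε) λₙ(deg + q) + C`, and the quotient tends to `1`.
-/

noncomputable section

namespace SparseGraph

/-! ### Sparseness and the quadratic form -/

section Combinatorics

variable {V : Type*} (G : SimpleGraph V)

open Classical in
lemma two_mul_inducedEdgeCount (W : Finset V) :
    2 * inducedEdgeCount G W = ∑ v ∈ W, ∑ w ∈ W, if G.Adj v w then (1 : ℝ) else 0 := by
  have : {p : V × V | p.1 ∈ W ∧ p.2 ∈ W ∧ G.Adj p.1 p.2} =
      (((W ×ˢ W).filter fun p => G.Adj p.1 p.2 : Finset (V × V)) : Set (V × V)) := by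
    ext p
    simp [and_assoc]
  rw [inducedEdgeCount, this, Set.ncard_coe_finset, Finset.card_filter, Finset.sum_product]
  push_cast
  ring

open Classical in
/-- A discrete layer cake estimate: a `k`-sparse graph has few edges joining two places where `g`
is large. Subtracting the minimal value of `g` reduces the claim to a smaller set. -/
lemma IsSparse.sum_min_le {k : ℝ} (hG : IsSparse G k) (W : Finset V) :
    ∀ g : V → ℝ, (∀ v ∈ W, 0 ≤ g v) →
      ∑ v ∈ W, ∑ w ∈ W, (if G.Adj v w then min (g v) (g w) else 0) ≤ k * ∑ v ∈ W, g v := by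
  induction W using Finset.strongInduction with
  | H W ih =>
    intro g hg
    rcases W.eq_empty_or_nonempty with rfl | hW
    · simp
    obtain ⟨v₀, hv₀, hmin⟩ := W.exists_min_image g hW
    have hW' : insert v₀ (W.erase v₀) = W := Finset.insert_erase hv₀
    have key := ih (W.erase v₀) (Finset.erase_ssubset hv₀) (fun v => g v - g v₀)
      (fun v hv => sub_nonneg.2 (hmin v (Finset.mem_of_mem_erase hv)))
    have h1 : ∑ v ∈ W, ∑ w ∈ W, (if G.Adj v w then min (g v) (g w) else 0) =
        g v₀ * (2 * inducedEdgeCount G W) +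
        ∑ v ∈ W, ∑ w ∈ W, (if G.Adj v w then min (g v - g v₀) (g w - g v₀) else 0) := by
      rw [two_mul_inducedEdgeCount, Finset.mul_sum, ← Finset.sum_add_distrib]
      refine Finset.sum_congr rfl fun v _ => ?_
      rw [Finset.mul_sum, ← Finset.sum_add_distrib]
      refine Finset.sum_congr rfl fun w _ => ?_
      split_ifs
      · rw [min_sub_sub_right]; ring
      · ring
    have h2 : ∑ v ∈ W, ∑ w ∈ W, (if G.Adj v w then min (g v - g v₀) (g w - g v₀) else 0) =
        ∑ v ∈ W.erase v₀, ∑ w ∈ W.erase v₀,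
          (if G.Adj v w then min (g v - g v₀) (g w - g v₀) else 0) := by
      rw [← Finset.sum_erase W (a := v₀)]
      · refine Finset.sum_congr rfl fun v hv => ?_
        rw [← Finset.sum_erase W (a := v₀)]
        split_ifs
        · rw [sub_self, min_eq_right]
          exact sub_nonneg.2 (hmin v (Finset.mem_of_mem_erase hv))
        · rfl
      · refine Finset.sum_eq_zero fun w hw => ?_
        split_ifs
        · rw [sub_self, min_eq_left]
          exact sub_nonneg.2 (hmin w hw)
        · rfl
    have h3 : ∑ v ∈ W, g v = g v₀ * W.card + ∑ v ∈ W.erase v₀, (g v - g v₀) := by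
      rw [Finset.sum_erase W (by simp), Finset.sum_sub_distrib]
      simp [mul_comm]
    rw [h1, h2, h3, mul_add]
    have := mul_le_mul_of_nonneg_left (hG W) (hg v₀ hv₀)
    linarith

lemma two_mul_mul_le_min {ε : ℝ} (h0 : 0 < ε) (a b : ℝ) :
    2 * (a * b) ≤ (1 / ε - ε) * min (a ^ 2) (b ^ 2) + ε * (a ^ 2 + b ^ 2) := by
  have key : ∀ x y : ℝ, 2 * (x * y) ≤ (1 / ε - ε) * x ^ 2 + ε * (x ^ 2 + y ^ 2) := by
    intro x y
    have h2 : (1 / ε - ε) * x ^ 2 + ε * (x ^ 2 + y ^ 2) - 2 * (x * y) = (x - ε * y) ^ 2 / ε := by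
      field_simp
      ring
    have h3 : 0 ≤ (x - ε * y) ^ 2 / ε := by positivity
    linarith
  rcases min_choice (a ^ 2) (b ^ 2) with h | h <;> rw [h]
  · exact key a b
  · have := key b a
    linarith

variable [G.LocallyFinite]

open Classical in
/-- The off-diagonal part of the form of `Δ + q` is controlled by `deg` and by the sparseness. -/
lemma IsSparse.sum_adj_le {k : ℝ} (hG : IsSparse G k) {ε : ℝ} (h0 : 0 < ε) (h1 : ε ≤ 1)
    (W : Finset V) (a : V → ℝ) (haW : ∀ v, v ∉ W → a v = 0) :
    ∑ v ∈ W, ∑ w ∈ G.neighborFinset v, a v * a w ≤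
      ε * ∑ v ∈ W, (G.degree v : ℝ) * a v ^ 2 + k / 2 * (1 / ε - ε) * ∑ v ∈ W, a v ^ 2 := by
  have hε : 0 ≤ 1 / ε - ε := by
    rw [sub_nonneg, le_div_iff₀ h0]
    nlinarith
  have hdeg : ∀ v ∈ W, ∑ w ∈ W, (if G.Adj v w then (1 : ℝ) else 0) ≤ G.degree v := by
    intro v _
    rw [Finset.sum_ite, Finset.sum_const_zero, add_zero, Finset.sum_const, nsmul_eq_mul, mul_one,
      Nat.cast_le, ← G.card_neighborFinset_eq_degree]
    refine Finset.card_le_card fun w hw => ?_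
    simpa using (Finset.mem_filter.1 hw).2
  have hsum : ∀ v ∈ W, ∑ w ∈ G.neighborFinset v, a v * a w =
      ∑ w ∈ W, if G.Adj v w then a v * a w else 0 := by
    intro v _
    rw [← Finset.sum_filter]
    symm
    refine Finset.sum_subset_zero_on_sdiff (fun w hw => ?_) (fun w hw => ?_) (fun _ _ => rfl)
    · simpa using (Finset.mem_filter.1 hw).2
    · rw [Finset.mem_sdiff, Finset.mem_filter, SimpleGraph.mem_neighborFinset] at hw
      rw [haW w fun h => hw.2 ⟨h, hw.1⟩, mul_zero]
  have hsymm : ∑ v ∈ W, ∑ w ∈ W, (if G.Adj v w then a w ^ 2 else 0) =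
      ∑ v ∈ W, ∑ w ∈ W, (if G.Adj v w then a v ^ 2 else 0) := by
    rw [Finset.sum_comm]
    simp_rw [G.adj_comm]
  have hd : ∑ v ∈ W, ∑ w ∈ W, (if G.Adj v w then a v ^ 2 else 0) ≤
      ∑ v ∈ W, (G.degree v : ℝ) * a v ^ 2 := by
    refine Finset.sum_le_sum fun v hv => ?_
    have := mul_le_mul_of_nonneg_right (hdeg v hv) (sq_nonneg (a v))
    rw [Finset.sum_mul] at this
    simpa using this
  have hm := hG.sum_min_le G W (fun v => a v ^ 2) (fun v _ => sq_nonneg _)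
  have hpt : ∑ v ∈ W, ∑ w ∈ W, (if G.Adj v w then 2 * (a v * a w) else 0) ≤
      ∑ v ∈ W, ∑ w ∈ W, ((1 / ε - ε) * (if G.Adj v w then min (a v ^ 2) (a w ^ 2) else 0) +
        ε * ((if G.Adj v w then a v ^ 2 else 0) + (if G.Adj v w then a w ^ 2 else 0))) := by
    refine Finset.sum_le_sum fun v _ => Finset.sum_le_sum fun w _ => ?_
    split_ifs
    · exact two_mul_mul_le_min h0 (a v) (a w)
    · simp
  simp_rw [Finset.sum_add_distrib, ← Finset.mul_sum, Finset.sum_add_distrib, hsymm] at hpt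
  have h2 : ∑ v ∈ W, ∑ w ∈ W, (if G.Adj v w then 2 * (a v * a w) else 0) =
      2 * ∑ v ∈ W, ∑ w ∈ W, (if G.Adj v w then a v * a w else 0) := by
    simp_rw [Finset.mul_sum, mul_ite, mul_zero]
  rw [Finset.sum_congr rfl hsum]
  have := mul_le_mul_of_nonneg_left hm hε
  have := mul_le_mul_of_nonneg_left hd h0.le
  linarith

end Combinatorics

/-! ### Cores, resolvents and square roots -/

section Hilbert

open scoped InnerProductSpace
open Filter Topology

variable {H : Type*} [NormedAddCommGroup H] [InnerProductSpace ℂ H]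

/-- `Γ` is the graph of the restriction of the non-negative operator `T` to a core on which `T` is
symmetric; moreover `T + 1` maps this core onto a dense subspace, expressed by the vanishing of its
orthogonal complement. Encoding the restriction by its graph in `H × H` makes passing to the closure
convenient. -/
structure IsGraphCore (T : H →ₗ.[ℂ] H) (Γ : Submodule ℂ (H × H)) : Prop where
  closure_eq : Γ.topologicalClosure = T.graph
  symm : ∀ p ∈ Γ, ∀ q ∈ T.graph, ⟪p.1, q.2⟫_ℂ = ⟪p.2, q.1⟫_ℂ
  nonneg : ∀ p ∈ T.graph, 0 ≤ (⟪p.1, p.2⟫_ℂ).re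
  dense : ∀ x : H, (∀ p ∈ Γ, ⟪p.1 + p.2, x⟫_ℂ = 0) → x = 0

/-- `R = (T + 1)⁻¹`, for a non-negative selfadjoint `T`. -/
structure IsNegOneResolvent (T : H →ₗ.[ℂ] H) (R : H →L[ℂ] H) : Prop where
  symm : ∀ x y, ⟪R x, y⟫_ℂ = ⟪x, R y⟫_ℂ
  nonneg : ∀ x, 0 ≤ (⟪x, R x⟫_ℂ).re
  nonneg' : ∀ x, 0 ≤ (⟪x, x - R x⟫_ℂ).re
  mem_graph : ∀ x y, (x, y) ∈ T.graph ↔ R (x + y) = x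

lemma IsGraphCore.le {T : H →ₗ.[ℂ] H} {Γ : Submodule ℂ (H × H)} (h : IsGraphCore T Γ) :
    Γ ≤ T.graph := by
  rw [← h.closure_eq]
  exact Γ.le_topologicalClosure

lemma IsGraphCore.exists_tendsto {T : H →ₗ.[ℂ] H} {Γ : Submodule ℂ (H × H)}
    (h : IsGraphCore T Γ) {p : H × H} (hp : p ∈ T.graph) :
    ∃ u : ℕ → H × H, (∀ n, u n ∈ Γ) ∧ Tendsto u atTop (𝓝 p) := by
  rw [← h.closure_eq, ← SetLike.mem_coe, Submodule.topologicalClosure_coe,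
    mem_closure_iff_seq_limit] at hp
  exact hp

lemma IsGraphCore.symm' {T : H →ₗ.[ℂ] H} {Γ : Submodule ℂ (H × H)} (h : IsGraphCore T Γ)
    {p q : H × H} (hp : p ∈ T.graph) (hq : q ∈ T.graph) : ⟪p.1, q.2⟫_ℂ = ⟪p.2, q.1⟫_ℂ := by
  obtain ⟨u, hu, hlim⟩ := h.exists_tendsto hp
  have h1 : Tendsto (fun n => ⟪(u n).1, q.2⟫_ℂ) atTop (𝓝 ⟪p.1, q.2⟫_ℂ) :=
    ((continuous_fst.tendsto p).comp hlim).inner tendsto_const_nhds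
  have h2 : Tendsto (fun n => ⟪(u n).2, q.1⟫_ℂ) atTop (𝓝 ⟪p.2, q.1⟫_ℂ) :=
    ((continuous_snd.tendsto p).comp hlim).inner tendsto_const_nhds
  refine tendsto_nhds_unique h1 (h2.congr fun n => (h.symm _ (hu n) _ hq).symm)

lemma IsNegOneResolvent.isPositive {T : H →ₗ.[ℂ] H} {R : H →L[ℂ] H}
    (h : IsNegOneResolvent T R) : R.IsPositive := by
  refine ⟨h.symm, fun x => ?_⟩
  rw [ContinuousLinearMap.reApplyInnerSelf_apply, inner_re_symm]
  exact h.nonneg x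

lemma IsNegOneResolvent.injective {T : H →ₗ.[ℂ] H} {R : H →L[ℂ] H}
    (h : IsNegOneResolvent T R) {x : H} (hx : R x = 0) : x = 0 := by
  have : ((0 : H), x) ∈ T.graph := (h.mem_graph 0 x).2 (by rwa [zero_add])
  exact T.graph_fst_eq_zero_snd this rfl

lemma IsNegOneResolvent.apply_mem_graph {T : H →ₗ.[ℂ] H} {R : H →L[ℂ] H}
    (h : IsNegOneResolvent T R) (x : H) : (R x, x - R x) ∈ T.graph :=
  (h.mem_graph _ _).2 (by rw [add_sub_cancel])

variable [CompleteSpace H]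

/-- If `Γ` is a symmetric non-negative linear relation and `{x + y | (x, y) ∈ Γ}` is dense, then
`x + y` runs through all of `H` for `(x, y)` in the closure of `Γ`: the map `(x, y) ↦ x + y` is
bounded below by non-negativity. -/
lemma exists_mem_closure_add_eq {Γ : Submodule ℂ (H × H)}
    (hpos : ∀ p ∈ Γ.topologicalClosure, 0 ≤ (⟪p.1, p.2⟫_ℂ).re)
    (hd : ∀ x : H, (∀ p ∈ Γ, ⟪p.1 + p.2, x⟫_ℂ = 0) → x = 0) (u : H) :
    ∃ p ∈ Γ.topologicalClosure, p.1 + p.2 = u := by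
  have hC : IsClosed (Γ.topologicalClosure : Set (H × H)) := Γ.isClosed_topologicalClosure
  have : CompleteSpace Γ.topologicalClosure := hC.completeSpace_coe
  let j : Γ.topologicalClosure →L[ℂ] H :=
    (ContinuousLinearMap.fst ℂ H H + ContinuousLinearMap.snd ℂ H H) ∘L
      Γ.topologicalClosure.subtypeL
  have hj : ∀ p, j p = p.1.1 + p.1.2 := fun p => rfl
  have hb : ∀ p, ‖p‖ ≤ (1 : NNReal) * ‖j p‖ := by
    intro p
    have h1 := norm_add_sq (𝕜 := ℂ) p.1.1 p.1.2
    have h2 := hpos p.1 p.2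
    simp only [RCLike.re_eq_complex_re] at h1
    rw [NNReal.coe_one, one_mul, hj, Submodule.coe_norm, Prod.norm_def, max_le_iff]
    constructor
    · exact le_of_sq_le_sq (by nlinarith [sq_nonneg ‖p.1.2‖]) (norm_nonneg _)
    · exact le_of_sq_le_sq (by nlinarith [sq_nonneg ‖p.1.1‖]) (norm_nonneg _)
  have hcl : IsClosed (Set.range j) :=
    (AddMonoidHomClass.antilipschitz_of_bound j hb).isClosed_range j.uniformContinuous
  have hdense : (LinearMap.range j.toLinearMap).topologicalClosure = ⊤ := by
    rw [Submodule.topologicalClosure_eq_top_iff, Submodule.eq_bot_iff]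
    intro x hx
    refine hd x fun p hp => ?_
    exact hx _ ⟨⟨p, Γ.le_topologicalClosure hp⟩, rfl⟩
  have hall : Set.range j = Set.univ := by
    have := congrArg (fun K : Submodule ℂ H => (K : Set H)) hdense
    simp only [Submodule.topologicalClosure_coe, Submodule.top_coe] at this
    rw [← hcl.closure_eq]
    exact this
  obtain ⟨p, hp⟩ : u ∈ Set.range j := hall ▸ Set.mem_univ u
  exact ⟨p.1, p.2, hp⟩

/-- A criterion for being a core: if `T` is contained in the adjoint of its restriction `Γ`, and
`T + 1` is injective, then `T` is the closure of `Γ`. -/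
lemma IsGraphCore.of_le {T : H →ₗ.[ℂ] H} {Γ : Submodule ℂ (H × H)} (hT : T.IsClosed)
    (hle : Γ ≤ T.graph) (symm : ∀ p ∈ Γ, ∀ q ∈ T.graph, ⟪p.1, q.2⟫_ℂ = ⟪p.2, q.1⟫_ℂ)
    (hpos : ∀ p ∈ Γ, 0 ≤ (⟪p.1, p.2⟫_ℂ).re)
    (hd : ∀ x : H, (∀ p ∈ Γ, ⟪p.1 + p.2, x⟫_ℂ = 0) → x = 0) : IsGraphCore T Γ := by
  have hpos' : ∀ p ∈ Γ.topologicalClosure, 0 ≤ (⟪p.1, p.2⟫_ℂ).re := by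
    intro p hp
    have hcl : IsClosed {p : H × H | 0 ≤ (⟪p.1, p.2⟫_ℂ).re} :=
      isClosed_le continuous_const (Complex.continuous_re.comp (continuous_fst.inner continuous_snd))
    exact closure_minimal (fun p hp => hpos p hp) hcl hp
  have hcle : Γ.topologicalClosure ≤ T.graph := Γ.topologicalClosure_minimal hle hT
  have heq : Γ.topologicalClosure = T.graph := by
    refine le_antisymm hcle ?_
    rintro p hp
    obtain ⟨p', hp', hsum⟩ := exists_mem_closure_add_eq hpos' hd (p.1 + p.2)
    have hdiff : p - p' ∈ T.graph := T.graph.sub_mem hp (hcle hp')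
    have hs : (p - p').2 = -(p - p').1 := by
      rw [eq_neg_iff_add_eq_zero, Prod.snd_sub, Prod.fst_sub, sub_add_sub_comm, add_comm p.2,
        add_comm p'.2, hsum, sub_self]
    have h0 : (p - p').1 = 0 := by
      refine hd _ fun q hq => ?_
      rw [inner_add_left, ← symm q hq _ hdiff, hs, inner_neg_right, add_neg_cancel]
    have : p = p' := by
      rw [← sub_eq_zero]
      exact Prod.ext h0 (by rw [hs, h0, neg_zero]; rfl)
    rwa [this]
  exact ⟨heq, symm, fun p hp => hpos' p (heq ▸ hp), hd⟩

lemma IsGraphCore.exists_resolvent {T : H →ₗ.[ℂ] H} {Γ : Submodule ℂ (H × H)}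
    (h : IsGraphCore T Γ) : ∃ R, IsNegOneResolvent T R := by
  have hnn : ∀ p ∈ Γ.topologicalClosure, 0 ≤ (⟪p.1, p.2⟫_ℂ).re := by
    rw [h.closure_eq]; exact h.nonneg
  have hsurj := exists_mem_closure_add_eq hnn h.dense
  rw [h.closure_eq] at hsurj
  have hsq : ∀ p ∈ T.graph, ‖p.1‖ ≤ ‖p.1 + p.2‖ := by
    intro p hp
    have h1 := norm_add_sq (𝕜 := ℂ) p.1 p.2
    have h2 := h.nonneg p hp
    simp only [RCLike.re_eq_complex_re] at h1
    exact le_of_sq_le_sq (by nlinarith [sq_nonneg ‖p.2‖]) (norm_nonneg _)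
  have huniq : ∀ p ∈ T.graph, ∀ p' ∈ T.graph, p.1 + p.2 = p'.1 + p'.2 → p.1 = p'.1 := by
    intro p hp p' hp' he
    have h3 := hsq _ (T.graph.sub_mem hp hp')
    rw [Prod.fst_sub, Prod.snd_sub, sub_add_sub_comm, he, sub_self, norm_zero] at h3
    exact sub_eq_zero.1 (norm_le_zero_iff.1 h3)
  choose r hr hrs using hsurj
  let R₀ : H →ₗ[ℂ] H :=
    { toFun := fun u => (r u).1
      map_add' := fun u v => by
        refine huniq _ (hr _) _ (T.graph.add_mem (hr u) (hr v)) ?_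
        rw [hrs, Prod.fst_add, Prod.snd_add, add_add_add_comm, hrs, hrs]
      map_smul' := fun c u => by
        refine huniq _ (hr _) _ (T.graph.smul_mem c (hr u)) ?_
        rw [hrs, Prod.smul_fst, Prod.smul_snd, ← smul_add, hrs] }
  let R : H →L[ℂ] H := R₀.mkContinuous 1 fun u => by
    have h3 := hsq _ (hr u)
    rw [hrs] at h3
    rw [one_mul]
    exact h3
  have hR : ∀ u, R u = (r u).1 := fun u => rfl
  have hR' : ∀ u, u - R u = (r u).2 := fun u => by
    rw [hR]
    nth_rw 1 [← hrs u]
    rw [add_sub_cancel_left]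
  refine ⟨R, ?_, ?_, ?_, ?_⟩
  · intro x y
    rw [hR, hR]
    nth_rw 1 [← hrs y]
    nth_rw 2 [← hrs x]
    rw [inner_add_left, inner_add_right, h.symm' (hr x) (hr y)]
  · intro x
    rw [hR]
    nth_rw 1 [← hrs x]
    rw [inner_add_left, Complex.add_re]
    have h1 := h.nonneg _ (hr x)
    have h2 : 0 ≤ (⟪(r x).1, (r x).1⟫_ℂ).re := inner_self_nonneg (𝕜 := ℂ)
    rw [← inner_conj_symm, Complex.conj_re] at h1
    linarith
  · intro x
    rw [hR']
    nth_rw 1 [← hrs x]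
    rw [inner_add_left, Complex.add_re]
    have h1 := h.nonneg _ (hr x)
    have h2 : 0 ≤ (⟪(r x).2, (r x).2⟫_ℂ).re := inner_self_nonneg (𝕜 := ℂ)
    linarith
  · intro x y
    rw [hR]
    constructor
    · intro hxy
      exact huniq _ (hr _) _ hxy (hrs _)
    · intro he
      have h1 : r (x + y) = (x, y) := by
        refine Prod.ext he ?_
        have := hrs (x + y)
        rw [he] at this
        exact add_left_cancel this
      exact h1 ▸ hr (x + y)

lemma IsNegOneResolvent.isSelfAdjoint {T : H →ₗ.[ℂ] H} {R : H →L[ℂ] H}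
    (h : IsNegOneResolvent T R) : IsSelfAdjoint R := h.isPositive.isSelfAdjoint

lemma IsNegOneResolvent.spectrum_subset {T : H →ₗ.[ℂ] H} {R : H →L[ℂ] H}
    (h : IsNegOneResolvent T R) {x : ℝ} (hx : x ∈ spectrum ℝ R) : 0 ≤ x ∧ x ≤ 1 := by
  constructor
  · exact spectrum_nonneg_of_nonneg ((ContinuousLinearMap.nonneg_iff_isPositive R).2 h.isPositive) hx
  · have hp : (1 - R).IsPositive := by
      refine ⟨fun x y => ?_, fun x => ?_⟩
      · simp only [ContinuousLinearMap.coe_coe, sub_apply,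
          one_apply_eq_self, inner_sub_left, inner_sub_right, h.symm]
      · rw [ContinuousLinearMap.reApplyInnerSelf_apply, inner_re_symm]
        exact h.nonneg' x
    have h1 : 1 - x ∈ spectrum ℝ (1 - R) := by
      have h2 := spectrum.singleton_sub_eq R (1 : ℝ)
      rw [map_one] at h2
      rw [← h2]
      exact ⟨1, rfl, x, hx, rfl⟩
    have := spectrum_nonneg_of_nonneg ((ContinuousLinearMap.nonneg_iff_isPositive _).2 hp) h1
    linarith

/-- The square root of `T = R⁻¹ - 1` is `B A⁻¹` with `A = √R` and `B = √(1 - R)`. -/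
lemma IsNegOneResolvent.exists_isNonnegSqrt {T : H →ₗ.[ℂ] H} {R : H →L[ℂ] H}
    (h : IsNegOneResolvent T R) : ∃ S, IsNonnegSqrt S T := by
  have hsa := h.isSelfAdjoint
  let A : H →L[ℂ] H := cfc Real.sqrt R
  let B : H →L[ℂ] H := cfc (fun x : ℝ => Real.sqrt (1 - x)) R
  let C : H →L[ℂ] H := cfc (fun x : ℝ => Real.sqrt (Real.sqrt x * Real.sqrt (1 - x))) R
  have hcA : ContinuousOn Real.sqrt (spectrum ℝ R) := Real.continuous_sqrt.continuousOn
  have hcB : ContinuousOn (fun x : ℝ => Real.sqrt (1 - x)) (spectrum ℝ R) := by fun_prop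
  have hcC : ContinuousOn (fun x : ℝ => Real.sqrt (Real.sqrt x * Real.sqrt (1 - x)))
      (spectrum ℝ R) := by fun_prop
  have hAA : A * A = R := by
    rw [← cfc_mul _ _ R hcA hcA]
    nth_rw 2 [← cfc_id ℝ R]
    exact cfc_congr fun x hx => Real.mul_self_sqrt (h.spectrum_subset hx).1
  have hBB : B * B = 1 - R := by
    rw [← cfc_mul _ _ R hcB hcB]
    have : cfc (fun x : ℝ => 1 - x) R = 1 - R := by
      rw [cfc_sub (fun _ : ℝ => (1 : ℝ)) (fun x => x) R, cfc_const_one ℝ R, cfc_id' ℝ R]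
    rw [← this]
    exact cfc_congr fun x hx => Real.mul_self_sqrt (sub_nonneg.2 (h.spectrum_subset hx).2)
  have hAB : A * B = B * A := cfc_commute_cfc _ _ R
  have hCC : C * C = A * B := by
    rw [← cfc_mul _ _ R hcC hcC, ← cfc_mul _ _ R hcA hcB]
    exact cfc_congr fun x _ => Real.mul_self_sqrt (by positivity)
  have hA (x y : H) : ⟪A x, y⟫_ℂ = ⟪x, A y⟫_ℂ :=
    ContinuousLinearMap.isSelfAdjoint_iff_isSymmetric.1 (cfc_predicate Real.sqrt R) x y
  have hB (x y : H) : ⟪B x, y⟫_ℂ = ⟪x, B y⟫_ℂ :=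
    ContinuousLinearMap.isSelfAdjoint_iff_isSymmetric.1
      (cfc_predicate (fun x : ℝ => Real.sqrt (1 - x)) R) x y
  have hC (x y : H) : ⟪C x, y⟫_ℂ = ⟪x, C y⟫_ℂ :=
    ContinuousLinearMap.isSelfAdjoint_iff_isSymmetric.1
      (cfc_predicate (fun x : ℝ => Real.sqrt (Real.sqrt x * Real.sqrt (1 - x))) R) x y
  have eAA (x : H) : A (A x) = R x := congrArg (fun K : H →L[ℂ] H => K x) hAA
  have eBB (x : H) : B (B x) = x - R x := congrArg (fun K : H →L[ℂ] H => K x) hBB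
  have eAB (x : H) : A (B x) = B (A x) := congrArg (fun K : H →L[ℂ] H => K x) hAB
  have eCC (x : H) : C (C x) = A (B x) := congrArg (fun K : H →L[ℂ] H => K x) hCC
  have hinj (x : H) (hx : A x = 0) : x = 0 := h.injective (by rw [← eAA, hx, map_zero])
  let g : Submodule ℂ (H × H) := LinearMap.range (A.toLinearMap.prod B.toLinearMap)
  have hg (p : H × H) : p ∈ g ↔ A p.2 = B p.1 := by
    constructor
    · rintro ⟨x, rfl⟩
      exact eAB x
    · intro hp
      refine ⟨A p.1 + B p.2, Prod.ext ?_ ?_⟩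
      · change A (A p.1 + B p.2) = p.1
        rw [map_add, eAB, hp, eAA, eBB, add_sub_cancel]
      · change B (A p.1 + B p.2) = p.2
        rw [map_add, ← eAB, ← hp, eAA, eBB, add_sub_cancel]
  let S : H →ₗ.[ℂ] H := g.toLinearPMap
  have hS : S.graph = g := by
    refine Submodule.toLinearPMap_graph_eq g fun p hp h0 => ?_
    rw [hg, h0, map_zero] at hp
    exact hinj _ hp
  have hdom (x : H) : A x ∈ S.domain :=
    LinearPMap.mem_domain_iff.2 ⟨B x, by rw [hS]; exact ⟨x, rfl⟩⟩
  have hdense : Dense (S.domain : Set H) := by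
    rw [Submodule.dense_iff_topologicalClosure_eq_top, Submodule.topologicalClosure_eq_top_iff,
      Submodule.eq_bot_iff]
    intro x hx
    refine hinj x (ext_inner_left ℂ fun y => ?_)
    rw [inner_zero_right, ← hA]
    exact hx _ (hdom y)
  refine ⟨S, ?_, ?_, ?_⟩
  · rw [LinearPMap.isSelfAdjoint_def]
    refine LinearPMap.eq_of_eq_graph ?_
    rw [LinearPMap.adjoint_graph_eq_graph_adjoint hdense, hS]
    ext p
    rw [Submodule.mem_adjoint_iff, hg]
    constructor
    · intro hp
      refine ext_inner_left ℂ fun y => ?_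
      have := hp (A y) (B y) ⟨y, rfl⟩
      rw [hA, hB, sub_eq_zero] at this
      exact this.symm
    · rintro hp _ _ ⟨y, hy⟩
      obtain ⟨rfl, rfl⟩ := Prod.ext_iff.1 hy
      change ⟪B y, _⟫_ℂ - ⟪A y, _⟫_ℂ = 0
      rw [hA, hB, hp, sub_self]
  · rintro x
    have hx := S.mem_graph x
    rw [hS] at hx
    obtain ⟨y, hy⟩ := hx
    obtain ⟨h1, h2⟩ := Prod.ext_iff.1 hy
    change A y = x at h1
    change B y = S x at h2
    rw [← h1, ← h2, hA, ← eCC, ← hC]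
    exact inner_self_nonneg (𝕜 := ℂ)
  · intro x z
    rw [h.mem_graph, hS]
    simp only [hg]
    constructor
    · intro hxz
      have hw : A (A (x + z)) = x := by rw [eAA, hxz]
      have hz : B (B (x + z)) = z := by rw [eBB, hxz, add_sub_cancel_left]
      refine ⟨A (B (x + z)), ?_, ?_⟩
      · rw [eAB, eAB, hw]
      · have := eAB (B (x + z))
        rwa [hz] at this
    · rintro ⟨y, h1, h2⟩
      have h3 : A (A z) = B (B x) := by rw [h2, eAB, h1]
      rw [eAA, eBB] at h3
      rw [map_add, h3, add_sub_cancel]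

lemma IsNonnegSqrt.symm {S T : H →ₗ.[ℂ] H} (hS : IsNonnegSqrt S T) {p q : H × H}
    (hp : p ∈ S.graph) (hq : q ∈ S.graph) : ⟪p.1, q.2⟫_ℂ = ⟪p.2, q.1⟫_ℂ := by
  have h1 := hS.1
  have h2 := LinearPMap.adjoint_graph_eq_graph_adjoint h1.dense_domain
  rw [LinearPMap.isSelfAdjoint_def.1 h1] at h2
  rw [h2, Submodule.mem_adjoint_iff] at hq
  exact (sub_eq_zero.1 (hq p.1 p.2 hp)).symm

lemma IsNonnegSqrt.norm_sq {S T : H →ₗ.[ℂ] H} (hS : IsNonnegSqrt S T) {x y z : H}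
    (hy : (x, y) ∈ S.graph) (hz : (x, z) ∈ T.graph) : ‖y‖ ^ 2 = (⟪x, z⟫_ℂ).re := by
  obtain ⟨y', h1, h2⟩ := (hS.2.2 x z).1 hz
  obtain rfl := S.mem_graph_snd_inj hy h1 rfl
  have := hS.symm h1 h2
  rw [this]
  exact (inner_self_eq_norm_sq (𝕜 := ℂ) y).symm

/-- A core of `T` is a core of its square root `S`, as `⟨x, f⟩ + ⟨S x, S f⟩ = ⟨x, (T + 1) f⟩`. -/
lemma IsGraphCore.exists_tendsto_sqrt {S T : H →ₗ.[ℂ] H} {Γ : Submodule ℂ (H × H)}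
    (h : IsGraphCore T Γ) (hS : IsNonnegSqrt S T) {p : H × H} (hp : p ∈ S.graph) :
    ∃ u : ℕ → H × H, (∀ n, u n ∈ S.graph ∧ ∃ z, ((u n).1, z) ∈ Γ) ∧ Tendsto u atTop (𝓝 p) := by
  let M : Submodule ℂ (H × H) := S.graph ⊓ (Γ.map (LinearMap.fst ℂ H H)).comap (LinearMap.fst ℂ H H)
  have hM : ∀ q, q ∈ M ↔ q ∈ S.graph ∧ ∃ z, (q.1, z) ∈ Γ := by
    intro q
    simp [M]
  let e := WithLp.prodContinuousLinearEquiv 2 ℂ H H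
  let M' : Submodule ℂ (WithLp 2 (H × H)) := M.comap e.toLinearMap
  have key : e.symm p ∈ M'.topologicalClosure := by
    -- The component of `p` orthogonal to the core within the graph of `S` vanishes.
    have hclS : IsClosed (S.graph : Set (H × H)) := hS.1.isClosed
    have : CompleteSpace M'.topologicalClosure := M'.isClosed_topologicalClosure.completeSpace_coe
    obtain ⟨a, ha, b, hb, hab⟩ :=
      M'.topologicalClosure.exists_add_mem_mem_orthogonal (e.symm p)
    have haS : e a ∈ S.graph := by
      have : M'.topologicalClosure ≤ S.graph.comap e.toLinearMap := by
        refine M'.topologicalClosure_minimal ?_ (hclS.preimage e.continuous)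
        exact fun q hq => ((hM _).1 hq).1
      exact this ha
    have hbS : e b ∈ S.graph := by
      have : e b = p - e a := by
        rw [eq_sub_iff_add_eq', ← map_add, ← hab, e.apply_symm_apply]
      rw [this]
      exact S.graph.sub_mem hp haS
    have hb0 : (e b).1 = 0 := by
      refine h.dense _ fun q hq => ?_
      obtain ⟨y, h1, h2⟩ := (hS.2.2 q.1 q.2).1 (h.le hq)
      have h3 : e.symm (q.1, y) ∈ M'.topologicalClosure :=
        M'.le_topologicalClosure ((hM _).2 ⟨h1, q.2, hq⟩)
      have h4 := hb _ h3
      rw [WithLp.prod_inner_apply] at h4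
      change ⟪q.1, (e b).1⟫_ℂ + ⟪y, (e b).2⟫_ℂ = 0 at h4
      rw [hS.symm h2 hbS] at h4
      rw [inner_add_left, h4]
    have hb1 : b = 0 := by
      refine e.injective ?_
      rw [map_zero]
      refine Prod.ext hb0 ?_
      exact S.graph_fst_eq_zero_snd hbS hb0
    rw [hab, hb1, add_zero]
    exact ha
  rw [← SetLike.mem_coe, Submodule.topologicalClosure_coe, mem_closure_iff_seq_limit] at key
  obtain ⟨u, hu, hlim⟩ := key
  refine ⟨fun n => e (u n), fun n => (hM _).1 (hu n), ?_⟩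
  have := (e.continuous.tendsto _).comp hlim
  rwa [e.apply_symm_apply] at this

/-- If the form of `T₂` is bounded by the form of `T₁` on a core of `T₁` that lies in the domain of
`T₂`, then the form domain of `T₁` is contained in that of `T₂`. -/
lemma IsGraphCore.sqrt_domain_le {S₁ S₂ T₁ T₂ : H →ₗ.[ℂ] H} {Γ₁ : Submodule ℂ (H × H)}
    (h₁ : IsGraphCore T₁ Γ₁) (hS₁ : IsNonnegSqrt S₁ T₁) (hS₂ : IsNonnegSqrt S₂ T₂) {a b : ℝ}
    (ha : 0 ≤ a) (hb : 0 ≤ b)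
    (hform : ∀ p ∈ Γ₁, ∃ z, (p.1, z) ∈ T₂.graph ∧
      (⟪p.1, z⟫_ℂ).re ≤ a * (⟪p.1, p.2⟫_ℂ).re + b * ‖p.1‖ ^ 2) :
    S₁.domain ≤ S₂.domain := by
  intro x hx
  obtain ⟨u, hu, hlim⟩ := h₁.exists_tendsto_sqrt hS₁ (S₁.mem_graph ⟨x, hx⟩)
  choose hu₁ z hz using hu
  have hex (n : ℕ) : ∃ y, ((u n).1, y) ∈ S₂.graph := by
    obtain ⟨z₂, hz₂, -⟩ := hform _ (hz n)
    obtain ⟨y, hy, -⟩ := (hS₂.2.2 _ _).1 hz₂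
    exact ⟨y, hy⟩
  choose y hy using hex
  have hest (m n : ℕ) : ‖y m - y n‖ ^ 2 ≤ (a + b) * ‖u m - u n‖ ^ 2 := by
    have hΓ := Γ₁.sub_mem (hz m) (hz n)
    obtain ⟨z₂, hz₂, hle⟩ := hform _ hΓ
    have e1 : ‖y m - y n‖ ^ 2 = _ := hS₂.norm_sq (S₂.graph.sub_mem (hy m) (hy n)) hz₂
    have e2 : ‖(u m - u n).2‖ ^ 2 = _ :=
      hS₁.norm_sq (S₁.graph.sub_mem (hu₁ m) (hu₁ n)) (h₁.le hΓ)
    have i1 : ‖(u m - u n).1‖ ≤ ‖u m - u n‖ := norm_fst_le _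
    have i2 : ‖(u m - u n).2‖ ≤ ‖u m - u n‖ := norm_snd_le _
    have i3 := mul_le_mul_of_nonneg_left (pow_le_pow_left₀ (norm_nonneg _) i1 2) hb
    have i4 := mul_le_mul_of_nonneg_left (pow_le_pow_left₀ (norm_nonneg _) i2 2) ha
    have hle' : ‖y m - y n‖ ^ 2 ≤ a * ‖(u m - u n).2‖ ^ 2 + b * ‖(u m - u n).1‖ ^ 2 := by
      rw [e1, e2]
      exact hle
    linarith
  have hcau : CauchySeq y := by
    have hc := hlim.cauchySeq
    rw [Metric.cauchySeq_iff] at hc ⊢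
    intro δ hδ
    obtain ⟨N, hN⟩ := hc (δ / (a + b + 1)) (by positivity)
    refine ⟨N, fun m hm n hn => ?_⟩
    have h1 := hN m hm n hn
    rw [dist_eq_norm] at h1 ⊢
    rw [lt_div_iff₀ (by positivity)] at h1
    refine lt_of_pow_lt_pow_left₀ 2 hδ.le ((hest m n).trans_lt ?_)
    refine lt_of_le_of_lt ?_ (pow_lt_pow_left₀ h1 (by positivity) two_ne_zero)
    rw [mul_pow, mul_comm]
    exact mul_le_mul_of_nonneg_left (by nlinarith) (sq_nonneg _)
  obtain ⟨w, hw⟩ := cauchySeq_tendsto_of_complete hcau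
  have hfst : Tendsto (fun n => (u n).1) atTop (𝓝 x) := (continuous_fst.tendsto _).comp hlim
  have hcl : IsClosed (S₂.graph : Set (H × H)) := hS₂.1.isClosed
  exact LinearPMap.mem_domain_of_mem_graph
    (hcl.mem_of_tendsto (hfst.prodMk_nhds hw) (Eventually.of_forall hy))

end Hilbert

/-! ### Schrödinger operators on sparse graphs -/

section Schrodinger

open scoped InnerProductSpace
open Filter Topology

variable {V : Type*}

lemma mem_graph_maximalOperator {L : (V → ℂ) →ₗ[ℂ] (V → ℂ)} {x y : L2 V} :
    (x, y) ∈ (maximalOperator L).graph ↔ (y : V → ℂ) = L x := by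
  rw [LinearPMap.mem_graph_iff]
  constructor
  · rintro ⟨z, rfl, rfl⟩
    rfl
  · intro h
    have hx : x ∈ (maximalOperator L).domain := by
      change Memℓp (L x) 2
      rw [← h]
      exact lp.memℓp y
    exact ⟨⟨x, hx⟩, rfl, lp.ext h.symm⟩

lemma mem_graph_mulOperator {g : V → ℝ} {x y : L2 V} :
    (x, y) ∈ (mulOperator g).graph ↔ ∀ v, y v = (g v : ℂ) * x v := by
  rw [mulOperator, mem_graph_maximalOperator, funext_iff]
  rfl

/-- The standard basis vector of `ℓ²(V)` at `v`. -/
def delta (v : V) : L2 V :=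
  letI := Classical.decEq V
  lp.single 2 v 1

open Classical in
lemma delta_apply (v w : V) : delta v w = if w = v then 1 else 0 := by
  rw [delta, lp.single_apply, Pi.single_apply]

@[simp]
lemma inner_delta_left (v : V) (x : L2 V) : ⟪delta v, x⟫_ℂ = x v := by
  classical
  rw [delta, lp.inner_single_left]
  simp

lemma orthonormal_delta : Orthonormal ℂ (delta : V → L2 V) := by
  classical
  rw [orthonormal_iff_ite]
  intro v w
  rw [inner_delta_left, delta_apply]

lemma sum_smul_delta {f : L2 V} {W : Finset V} (hf : ∀ v, v ∉ W → f v = 0) :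
    ∑ v ∈ W, f v • delta v = f := by
  classical
  refine lp.ext (funext fun w => ?_)
  rw [lp.coeFn_sum, Finset.sum_apply]
  simp only [lp.coeFn_smul, Pi.smul_apply, delta_apply, smul_eq_mul, mul_ite, mul_one, mul_zero]
  rw [Finset.sum_ite_eq]
  split_ifs with h
  · rfl
  · exact (hf w h).symm

lemma inner_eq_sum {f : L2 V} {W : Finset V} (hf : ∀ v, v ∉ W → f v = 0) (y : L2 V) :
    ⟪f, y⟫_ℂ = ∑ v ∈ W, (starRingEnd ℂ) (f v) * y v := by
  nth_rw 1 [← sum_smul_delta hf]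
  simp_rw [sum_inner, inner_smul_left, inner_delta_left]

lemma norm_sq_eq_sum {f : L2 V} {W : Finset V} (hf : ∀ v, v ∉ W → f v = 0) :
    ‖f‖ ^ 2 = ∑ v ∈ W, ‖f v‖ ^ 2 := by
  have h1 : ‖f‖ ^ 2 = (⟪f, f⟫_ℂ).re := (inner_self_eq_norm_sq (𝕜 := ℂ) f).symm
  rw [h1, inner_eq_sum hf, Complex.re_sum]
  refine Finset.sum_congr rfl fun v _ => ?_
  rw [← Complex.normSq_eq_conj_mul_self, Complex.ofReal_re, Complex.normSq_eq_norm_sq]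

lemma re_inner_mul_eq_sum {g : V → ℝ} {f z : L2 V} {W : Finset V} (hf : ∀ v, v ∉ W → f v = 0)
    (hz : ∀ v, z v = (g v : ℂ) * f v) : (⟪f, z⟫_ℂ).re = ∑ v ∈ W, g v * ‖f v‖ ^ 2 := by
  rw [inner_eq_sum hf, Complex.re_sum]
  refine Finset.sum_congr rfl fun v _ => ?_
  rw [hz, mul_left_comm, ← Complex.normSq_eq_conj_mul_self, ← Complex.ofReal_mul,
    Complex.ofReal_re, Complex.normSq_eq_norm_sq]

variable (G : SimpleGraph V) [G.LocallyFinite] (q : V → ℝ)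

variable {G q} in
lemma mem_graph_schrodinger {x y : L2 V} : (x, y) ∈ (schrodinger G q).graph ↔
    ∀ v, y v = (degPlus G q v : ℂ) * x v - ∑ w ∈ G.neighborFinset v, x w := by
  rw [schrodinger, mem_graph_maximalOperator, funext_iff]
  refine forall_congr' fun v => ?_
  change y v = ∑ w ∈ G.neighborFinset v, (x v - x w) + (q v : ℂ) * x v ↔ _
  rw [Finset.sum_sub_distrib, Finset.sum_const, G.card_neighborFinset_eq_degree, degPlus]
  push_cast
  rw [nsmul_eq_mul, add_mul, sub_add_eq_add_sub]

/-- `(Δ + q) δ_v`. -/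
def schrodingerDelta (v : V) : L2 V :=
  (degPlus G q v : ℂ) • delta v - ∑ w ∈ G.neighborFinset v, delta w

lemma inner_schrodingerDelta (v : V) (x : L2 V) : ⟪schrodingerDelta G q v, x⟫_ℂ =
    (degPlus G q v : ℂ) * x v - ∑ w ∈ G.neighborFinset v, x w := by
  rw [schrodingerDelta, inner_sub_left, inner_smul_left, sum_inner]
  simp_rw [inner_delta_left]
  rw [Complex.conj_ofReal]

lemma schrodingerDelta_mem_graph (v : V) :
    (delta v, schrodingerDelta G q v) ∈ (schrodinger G q).graph := by
  classical
  rw [mem_graph_schrodinger]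
  intro u
  simp only [schrodingerDelta, lp.coeFn_sub, lp.coeFn_smul, lp.coeFn_sum, Pi.sub_apply,
    Pi.smul_apply, Finset.sum_apply, delta_apply, smul_eq_mul]
  rw [Finset.sum_ite_eq, Finset.sum_ite_eq']
  simp only [SimpleGraph.mem_neighborFinset, G.adj_comm u v]
  congr 1
  split_ifs with h
  · rw [h]
  · simp

/-- The graph of the restriction of `Δ + q` to the finitely supported functions. -/
def finSuppGraph : Submodule ℂ (L2 V × L2 V) :=
  Submodule.span ℂ (Set.range fun v => (delta v, schrodingerDelta G q v))

lemma finSuppGraph_le : finSuppGraph G q ≤ (schrodinger G q).graph := by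
  refine Submodule.span_le.2 ?_
  rintro _ ⟨v, rfl⟩
  exact schrodingerDelta_mem_graph G q v

lemma exists_mem_finSuppGraph {f : L2 V} {W : Finset V} (hf : ∀ v, v ∉ W → f v = 0) :
    ∃ y, (f, y) ∈ finSuppGraph G q := by
  refine ⟨∑ v ∈ W, f v • schrodingerDelta G q v, ?_⟩
  have : (f, ∑ v ∈ W, f v • schrodingerDelta G q v) =
      ∑ v ∈ W, f v • (delta v, schrodingerDelta G q v) := by
    refine Prod.ext ?_ ?_
    · rw [Prod.fst_sum]
      exact (sum_smul_delta hf).symm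
    · rw [Prod.snd_sum]
      rfl
  rw [this]
  exact Submodule.sum_mem _ fun v _ =>
    Submodule.smul_mem _ _ (Submodule.subset_span ⟨v, rfl⟩)

variable {G q} in
lemma exists_support_subset {p : L2 V × L2 V} (hp : p ∈ finSuppGraph G q) :
    ∃ W : Finset V, ∀ v, v ∉ W → p.1 v = 0 := by
  classical
  induction hp using Submodule.span_induction with
  | mem p hp =>
    obtain ⟨v, rfl⟩ := hp
    refine ⟨{v}, fun w hw => ?_⟩
    rw [delta_apply, if_neg (by simpa using hw)]
  | zero => exact ⟨∅, fun v _ => rfl⟩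
  | add p p' _ _ h h' =>
    obtain ⟨W, hW⟩ := h
    obtain ⟨W', hW'⟩ := h'
    refine ⟨W ∪ W', fun v hv => ?_⟩
    rw [Finset.mem_union, not_or] at hv
    rw [Prod.fst_add, lp.coeFn_add, Pi.add_apply, hW v hv.1, hW' v hv.2, add_zero]
  | smul c p _ h =>
    obtain ⟨W, hW⟩ := h
    refine ⟨W, fun v hv => ?_⟩
    rw [Prod.smul_fst, lp.coeFn_smul, Pi.smul_apply, hW v hv, smul_zero]

variable {G q}

/-- The form comparison between `Δ + q` and `deg + q` on finitely supported functions. -/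
lemma IsSparse.abs_form_sub_le {k : ℝ} (hG : IsSparse G k) (hq : ∀ v, 0 ≤ q v) {ε : ℝ}
    (h0 : 0 < ε) (h1 : ε ≤ 1) {f y : L2 V} (hy : (f, y) ∈ (schrodinger G q).graph)
    {W : Finset V} (hf : ∀ v, v ∉ W → f v = 0) :
    |(⟪f, y⟫_ℂ).re - ∑ v ∈ W, degPlus G q v * ‖f v‖ ^ 2| ≤
      ε * ∑ v ∈ W, degPlus G q v * ‖f v‖ ^ 2 + k / 2 * (1 / ε - ε) * ‖f‖ ^ 2 := by
  rw [mem_graph_schrodinger] at hy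
  have hform : (⟪f, y⟫_ℂ).re = ∑ v ∈ W, degPlus G q v * ‖f v‖ ^ 2 -
      (∑ v ∈ W, ∑ w ∈ G.neighborFinset v, (starRingEnd ℂ) (f v) * f w).re := by
    rw [inner_eq_sum hf]
    simp_rw [hy, mul_sub, Finset.sum_sub_distrib, Finset.mul_sum]
    rw [Complex.sub_re, Complex.re_sum]
    congr 1
    refine Finset.sum_congr rfl fun v _ => ?_
    rw [mul_left_comm, ← Complex.normSq_eq_conj_mul_self, ← Complex.ofReal_mul,
      Complex.ofReal_re, Complex.normSq_eq_norm_sq]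
  have hoff : ‖∑ v ∈ W, ∑ w ∈ G.neighborFinset v, (starRingEnd ℂ) (f v) * f w‖ ≤
      ∑ v ∈ W, ∑ w ∈ G.neighborFinset v, ‖f v‖ * ‖f w‖ := by
    refine (norm_sum_le _ _).trans (Finset.sum_le_sum fun v _ => ?_)
    refine (norm_sum_le _ _).trans (Finset.sum_le_sum fun w _ => ?_)
    rw [norm_mul, RCLike.norm_conj]
  have hsp := hG.sum_adj_le G h0 h1 W (fun v => ‖f v‖) (fun v hv => by rw [hf v hv, norm_zero])
  rw [← norm_sq_eq_sum hf] at hsp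
  have hdeg : ∑ v ∈ W, (G.degree v : ℝ) * ‖f v‖ ^ 2 ≤ ∑ v ∈ W, degPlus G q v * ‖f v‖ ^ 2 :=
    Finset.sum_le_sum fun v _ => mul_le_mul_of_nonneg_right
      (le_add_of_nonneg_right (hq v)) (sq_nonneg _)
  have := mul_le_mul_of_nonneg_left hdeg h0.le
  rw [hform, sub_sub_cancel_left, abs_neg]
  exact (Complex.abs_re_le_norm _).trans (hoff.trans (hsp.trans (by linarith)))

lemma isClosed_schrodinger : (schrodinger G q).IsClosed := by
  have : ((schrodinger G q).graph : Set (L2 V × L2 V)) =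
      ⋂ v, {p | ⟪delta v, p.2⟫_ℂ = ⟪schrodingerDelta G q v, p.1⟫_ℂ} := by
    ext ⟨x, y⟩
    rw [SetLike.mem_coe, mem_graph_schrodinger, Set.mem_iInter]
    refine forall_congr' fun v => ?_
    rw [← inner_schrodingerDelta, ← inner_delta_left v y]
    rfl
  rw [LinearPMap.IsClosed, this]
  exact isClosed_iInter fun v => isClosed_eq
    (continuous_const.inner continuous_snd) (continuous_const.inner continuous_fst)

/-- The maximum principle: a square summable function attains the maximum of its modulus, and a
solution of `(Δ + q + 1) x = 0` vanishes there. -/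
lemma eq_zero_of_schrodinger_eq_neg (hq : ∀ v, 0 ≤ q v) {x : L2 V}
    (hx : (x, -x) ∈ (schrodinger G q).graph) : x = 0 := by
  rw [mem_graph_schrodinger] at hx
  by_contra hne
  obtain ⟨u, hu⟩ : ∃ u, x u ≠ 0 := by
    by_contra! h
    exact hne (lp.ext (funext h))
  have hsum : Summable fun v => ‖x v‖ ^ (2 : ℝ) := by
    have := (lp.memℓp x).summable (by norm_num)
    simpa using this
  have hfin : {v | ‖x u‖ ≤ ‖x v‖}.Finite := by
    have h1 := hsum.tendsto_cofinite_zero.eventually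
      (gt_mem_nhds (show (0 : ℝ) < ‖x u‖ ^ (2 : ℝ) by positivity))
    rw [eventually_cofinite] at h1
    refine h1.subset fun v hv => ?_
    rw [Set.mem_ofPred_eq, not_lt]
    exact Real.rpow_le_rpow (norm_nonneg _) hv (by norm_num)
  obtain ⟨m, hm, hmax⟩ := Set.exists_max_image _ (fun v => ‖x v‖) hfin ⟨u, le_refl ‖x u‖⟩
  have hm' : ∀ v, ‖x v‖ ≤ ‖x m‖ := by
    intro v
    by_cases hv : ‖x u‖ ≤ ‖x v‖
    · exact hmax v hv
    · exact (not_le.1 hv).le.trans hm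
  have hpos : 0 < ‖x m‖ := lt_of_lt_of_le (norm_pos_iff.2 hu) hm
  have heq : ((degPlus G q m + 1 : ℝ) : ℂ) * x m = ∑ w ∈ G.neighborFinset m, x w := by
    have := hx m
    rw [lp.coeFn_neg, Pi.neg_apply] at this
    push_cast
    linear_combination -this
  have hdq : 0 ≤ degPlus G q m + 1 := by
    have := hq m
    rw [degPlus]
    positivity
  have hle : (degPlus G q m + 1) * ‖x m‖ ≤ G.degree m * ‖x m‖ := by
    have h2 : ‖∑ w ∈ G.neighborFinset m, x w‖ ≤ G.degree m * ‖x m‖ := by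
      refine (norm_sum_le_of_le _ fun w _ => hm' w).trans ?_
      rw [Finset.sum_const, G.card_neighborFinset_eq_degree, nsmul_eq_mul]
    rwa [← heq, norm_mul, Complex.norm_of_nonneg hdq] at h2
  have := le_of_mul_le_mul_right hle hpos
  rw [degPlus] at this
  linarith [hq m]

/-- The finitely supported functions form a core of `Δ + q`. -/
lemma IsSparse.isGraphCore {k : ℝ} (hG : IsSparse G k) (hq : ∀ v, 0 ≤ q v) :
    IsGraphCore (schrodinger G q) (finSuppGraph G q) := by
  refine .of_le isClosed_schrodinger (finSuppGraph_le G q) ?_ ?_ ?_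
  · rintro p hp ⟨x, y⟩ hxy
    rw [mem_graph_schrodinger] at hxy
    induction hp using Submodule.span_induction with
    | mem p hp =>
      obtain ⟨v, rfl⟩ := hp
      rw [inner_delta_left, inner_schrodingerDelta, hxy]
    | zero => simp
    | add p p' _ _ h h' =>
      rw [Prod.fst_add, Prod.snd_add, inner_add_left, inner_add_left, h, h']
    | smul c p _ h =>
      rw [Prod.smul_fst, Prod.smul_snd, inner_smul_left, inner_smul_left, h]
  · intro p hp
    obtain ⟨W, hW⟩ := exists_support_subset hp
    -- For `ε = 1` the lower bound of the form comparison is zero.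
    have := hG.abs_form_sub_le hq one_pos le_rfl (y := p.2) (finSuppGraph_le G q hp) hW
    norm_num at this
    linarith [(abs_le.1 this).1]
  · intro x hx
    refine eq_zero_of_schrodinger_eq_neg (G := G) hq (mem_graph_schrodinger.2 fun v => ?_)
    have := hx _ (Submodule.subset_span ⟨v, rfl⟩)
    rw [inner_add_left, inner_delta_left, inner_schrodingerDelta] at this
    rw [lp.coeFn_neg, Pi.neg_apply]
    linear_combination -this

/-- Multiplication operators are Schrödinger operators on the graph without edges. -/
lemma exists_mulOperator_eq_schrodinger (g : V → ℝ) :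
    ∃ _ : (⊥ : SimpleGraph V).LocallyFinite, mulOperator g = schrodinger ⊥ g := by
  have he (v : V) : (⊥ : SimpleGraph V).neighborSet v = ∅ := by
    ext; simp
  let I : (⊥ : SimpleGraph V).LocallyFinite := fun v =>
    have : IsEmpty ((⊥ : SimpleGraph V).neighborSet v) := Set.isEmpty_coe_sort.2 (he v)
    Fintype.ofIsEmpty
  refine ⟨I, LinearPMap.eq_of_eq_graph ?_⟩
  ext ⟨x, y⟩
  rw [mem_graph_schrodinger, mem_graph_mulOperator]
  refine forall_congr' fun v => ?_
  simp [degPlus]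

lemma isSparse_bot : IsSparse (⊥ : SimpleGraph V) 0 := by
  intro W
  simp [inducedEdgeCount]

lemma exists_isGraphCore_mulOperator {g : V → ℝ} (hg : ∀ v, 0 ≤ g v) :
    ∃ Γ, IsGraphCore (mulOperator g) Γ ∧
      ∀ p ∈ Γ, ∃ W : Finset V, ∀ v, v ∉ W → p.1 v = 0 := by
  obtain ⟨_, h⟩ := exists_mulOperator_eq_schrodinger g
  rw [h]
  exact ⟨_, isSparse_bot.isGraphCore hg, fun p hp => exists_support_subset hp⟩

lemma mem_graph_mulOperator_of_support {g : V → ℝ} {f : L2 V} {W : Finset V}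
    (hf : ∀ v, v ∉ W → f v = 0) : ∃ z, (f, z) ∈ (mulOperator g).graph := by
  obtain ⟨_, h⟩ := exists_mulOperator_eq_schrodinger g
  rw [h]
  obtain ⟨y, hy⟩ := exists_mem_finSuppGraph ⊥ g hf
  exact ⟨y, finSuppGraph_le _ _ hy⟩

lemma degPlus_nonneg (hq : ∀ v, 0 ≤ q v) (v : V) : 0 ≤ degPlus G q v :=
  add_nonneg (Nat.cast_nonneg _) (hq v)

theorem IsSparse.sqrt_domain_eq {k : ℝ} (hG : IsSparse G k) (hq : ∀ v, 0 ≤ q v)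
    {S₁ S₂ : L2 V →ₗ.[ℂ] L2 V} (h₁ : IsNonnegSqrt S₁ (schrodinger G q))
    (h₂ : IsNonnegSqrt S₂ (mulOperator (degPlus G q))) : S₁.domain = S₂.domain := by
  obtain ⟨Γ, hΓ, hsupp⟩ := exists_isGraphCore_mulOperator (degPlus_nonneg (G := G) hq)
  refine le_antisymm ?_ ?_
  · refine (hG.isGraphCore hq).sqrt_domain_le h₁ h₂ (a := 2) (b := |k| * (3 / 2)) (by norm_num)
      (by positivity) fun p hp => ?_
    obtain ⟨W, hW⟩ := exists_support_subset hp
    obtain ⟨z, hz⟩ := mem_graph_mulOperator_of_support (g := degPlus G q) hW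
    refine ⟨z, hz, ?_⟩
    have := hG.abs_form_sub_le hq (ε := 1 / 2) (by norm_num) (by norm_num) (y := p.2)
      (finSuppGraph_le G q hp) hW
    rw [re_inner_mul_eq_sum hW (mem_graph_mulOperator.1 hz)]
    norm_num at this
    have h2 := (abs_le.1 this).1
    have h3 := mul_le_mul_of_nonneg_right (le_abs_self k) (sq_nonneg ‖p.1‖)
    linarith
  · refine hΓ.sqrt_domain_le h₂ h₁ (a := 2) (b := 0) (by norm_num) le_rfl fun p hp => ?_
    obtain ⟨W, hW⟩ := hsupp p hp
    obtain ⟨y, hy⟩ := exists_mem_finSuppGraph G q hW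
    refine ⟨y, finSuppGraph_le G q hy, ?_⟩
    have := hG.abs_form_sub_le hq one_pos le_rfl (finSuppGraph_le G q hy) hW
    rw [re_inner_mul_eq_sum hW (mem_graph_mulOperator.1 (hΓ.le hp))]
    norm_num at this
    linarith [(abs_le.1 this).2]

/-- The lower form bound extends from the finitely supported functions to the domain of `Δ + q`;
finite partial sums make up for the unknown summability of `(deg + q) |x| ^ 2`. -/
lemma IsSparse.sum_degPlus_le {k : ℝ} (hG : IsSparse G k) (hq : ∀ v, 0 ≤ q v) {ε : ℝ}
    (h0 : 0 < ε) (h1 : ε ≤ 1) {x y : L2 V} (hxy : (x, y) ∈ (schrodinger G q).graph)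
    (W : Finset V) :
    (1 - ε) * ∑ v ∈ W, degPlus G q v * ‖x v‖ ^ 2 ≤
      (⟪x, y⟫_ℂ).re + k / 2 * (1 / ε - ε) * ‖x‖ ^ 2 := by
  classical
  obtain ⟨u, hu, hlim⟩ := (hG.isGraphCore hq).exists_tendsto hxy
  have l1 : Tendsto (fun n => (u n).1) atTop (𝓝 x) := (continuous_fst.tendsto _).comp hlim
  have l2 : Tendsto (fun n => (u n).2) atTop (𝓝 y) := (continuous_snd.tendsto _).comp hlim
  have l3 : Tendsto (fun n => (1 - ε) * ∑ v ∈ W, degPlus G q v * ‖(u n).1 v‖ ^ 2) atTop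
      (𝓝 ((1 - ε) * ∑ v ∈ W, degPlus G q v * ‖x v‖ ^ 2)) := by
    refine (tendsto_finsetSum _ fun v _ => ?_).const_mul _
    refine Tendsto.const_mul _ (Tendsto.pow ?_ 2)
    have : Tendsto (fun n => ⟪delta v, (u n).1⟫_ℂ) atTop (𝓝 ⟪delta v, x⟫_ℂ) :=
      tendsto_const_nhds.inner l1
    simp_rw [inner_delta_left] at this
    exact this.norm
  have l4 : Tendsto (fun n => (⟪(u n).1, (u n).2⟫_ℂ).re + k / 2 * (1 / ε - ε) * ‖(u n).1‖ ^ 2)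
      atTop (𝓝 ((⟪x, y⟫_ℂ).re + k / 2 * (1 / ε - ε) * ‖x‖ ^ 2)) :=
    ((Complex.continuous_re.tendsto _).comp (l1.inner l2)).add ((l1.norm.pow 2).const_mul _)
  refine le_of_tendsto_of_tendsto' l3 l4 fun n => ?_
  obtain ⟨F, hF⟩ := exists_support_subset (hu n)
  have hb := (abs_le.1 (hG.abs_form_sub_le hq h0 h1 (y := (u n).2) (finSuppGraph_le G q (hu n))
    (W := F ∪ W) fun v hv => hF v fun h => hv (Finset.mem_union_left _ h))).1
  have hmono : ∑ v ∈ W, degPlus G q v * ‖(u n).1 v‖ ^ 2 ≤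
      ∑ v ∈ F ∪ W, degPlus G q v * ‖(u n).1 v‖ ^ 2 :=
    Finset.sum_le_sum_of_subset_of_nonneg Finset.subset_union_right
      fun v _ _ => mul_nonneg (degPlus_nonneg hq v) (sq_nonneg _)
  have := mul_le_mul_of_nonneg_left hmono (sub_nonneg.2 h1)
  linarith

end Schrodinger

/-! ### Diagonal operators with discrete eigenvalues -/

section Diagonal

open scoped InnerProductSpace
open Filter Topology

/-- A family of reals whose sublevel sets are finite keeps a positive distance from each complex
number that is not one of its values. -/
lemma exists_pos_le_norm_sub {ι : Type*} {lam : ι → ℝ} (hfin : ∀ c, {i | lam i ≤ c}.Finite)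
    (z : ℂ) : ∃ d : ℝ, 0 < d ∧ ∀ i, (lam i : ℂ) ≠ z → d ≤ ‖(lam i : ℂ) - z‖ := by
  classical
  let F := ((hfin (‖z‖ + 1)).toFinset.filter fun i => (lam i : ℂ) ≠ z)
  have hout : ∀ i, i ∉ F → (lam i : ℂ) ≠ z → 1 ≤ ‖(lam i : ℂ) - z‖ := by
    intro i hi hne
    have h1 : ‖z‖ + 1 < lam i := by
      by_contra! h
      exact hi (Finset.mem_filter.2 ⟨(Set.Finite.mem_toFinset _).2 h, hne⟩)
    have h2 := norm_sub_norm_le (lam i : ℂ) z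
    rw [Complex.norm_real, Real.norm_eq_abs] at h2
    linarith [le_abs_self (lam i)]
  rcases F.eq_empty_or_nonempty with hF | hF
  · exact ⟨1, one_pos, fun i hi => hout i (by simp [hF]) hi⟩
  · obtain ⟨j, hj, hmin⟩ := F.exists_min_image (fun i => ‖(lam i : ℂ) - z‖) hF
    refine ⟨min 1 ‖(lam j : ℂ) - z‖, lt_min one_pos ?_, fun i hi => ?_⟩
    · exact norm_pos_iff.2 (sub_ne_zero.2 (Finset.mem_filter.1 hj).2)
    · by_cases hiF : i ∈ F
      · exact (min_le_right _ _).trans (hmin i hiF)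
      · exact (min_le_left _ _).trans (hout i hiF hi)

/-- An infinite family of reals with finite sublevel sets can be listed in increasing order. -/
lemma exists_equiv_monotone {ι : Type*} [Infinite ι] {lam : ι → ℝ}
    (hfin : ∀ c, {i | lam i ≤ c}.Finite) : ∃ e : ℕ ≃ ι, Monotone fun n => lam (e n) := by
  classical
  have hcount : Countable ι := by
    have h1 : (Set.univ : Set ι) = ⋃ n : ℕ, {i | lam i ≤ n} := by
      ext i
      simpa using exists_nat_ge (lam i)
    rw [← Set.countable_univ_iff, h1]
    exact Set.countable_iUnion fun n => (hfin n).countable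
  obtain ⟨ν, hν⟩ := hcount.exists_injective_nat
  -- Ties are broken by an arbitrary enumeration.
  let key : ι → ℝ ×ₗ ℕ := fun i => toLex (lam i, ν i)
  have hkey : Function.Injective key := by
    intro i j h
    exact hν (Prod.ext_iff.1 (toLex.injective h)).2
  let _ : LinearOrder ι := LinearOrder.lift' key hkey
  have hle : ∀ i j : ι, i ≤ j → lam i ≤ lam j := by
    intro i j h
    have h' : key i ≤ key j := h
    rw [Prod.Lex.le_iff] at h'
    rcases h' with h' | h'
    · exact h'.le
    · exact h'.1.le
  have hIic : ∀ j : ι, (Set.Iic j).Finite := fun j =>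
    (hfin (lam j)).subset fun i hi => hle i j hi
  have hIio : ∀ j : ι, (Set.Iio j).Finite := fun j => (hIic j).subset Set.Iio_subset_Iic_self
  let rank : ι → ℕ := fun j => (hIio j).toFinset.card
  have hmono : StrictMono rank := by
    intro i j hij
    refine Finset.card_lt_card ((Set.Finite.toFinset_ssubset_toFinset).2 ?_)
    exact ⟨Set.Iio_subset_Iio hij.le, fun h => lt_irrefl i (h hij)⟩
  have hsurj : Function.Surjective rank := by
    intro n
    induction n using Nat.strong_induction_on with
    | _ n ih =>
      choose! f hf using ih
      -- The least element that is not the preimage of a smaller number has rank `n`.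
      let S : Set ι := {i | n ≤ rank i}
      have hS : S.Nonempty := by
        by_contra hS
        have : (Set.univ : Set ι).Finite := by
          refine Set.Finite.of_finite_image ((Set.finite_lt_nat n).subset ?_)
            (hmono.injective.injOn (s := Set.univ))
          rintro _ ⟨i, -, rfl⟩
          by_contra h
          exact hS ⟨i, (not_lt.1 h : n ≤ rank i)⟩
        exact Set.infinite_univ this
      obtain ⟨i₀, hi₀⟩ := hS
      obtain ⟨i, hi, hmin⟩ := Set.exists_min_image (S ∩ Set.Iic i₀) id
        ((hIic i₀).subset Set.inter_subset_right) ⟨i₀, hi₀, le_refl i₀⟩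
      refine ⟨i, le_antisymm ?_ hi.1⟩
      have hsub : (hIio i).toFinset ⊆ (Finset.range n).image f := by
        intro j hj
        rw [Set.Finite.mem_toFinset, Set.mem_Iio] at hj
        have hjn : rank j < n := by
          by_contra! h
          exact absurd (hmin j ⟨h, hj.le.trans hi.2⟩) (not_le.2 hj)
        refine Finset.mem_image.2 ⟨rank j, Finset.mem_range.2 hjn, ?_⟩
        exact hmono.injective (hf _ hjn)
      exact (Finset.card_le_card hsub).trans (Finset.card_image_le.trans (Finset.card_range n).le)
  let e := (Equiv.ofBijective rank ⟨hmono.injective, hsurj⟩).symm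
  refine ⟨e, fun m n hmn => hle _ _ ?_⟩
  rw [← hmono.le_iff_le]
  have he : ∀ n, rank (e n) = n := (Equiv.ofBijective rank ⟨hmono.injective, hsurj⟩).apply_symm_apply
  rwa [he, he]

variable {H : Type*} [NormedAddCommGroup H] [InnerProductSpace ℂ H] {ι : Type*}

/-- `T` is the maximal diagonal operator with real eigenvalues `lam i` in the Hilbert basis `b`. -/
def IsDiagonal (T : H →ₗ.[ℂ] H) (b : HilbertBasis ι ℂ H) (lam : ι → ℝ) : Prop :=
  ∀ x y, (x, y) ∈ T.graph ↔ ∀ i, b.repr y i = (lam i : ℂ) * b.repr x i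

lemma hilbertBasis_ext (b : HilbertBasis ι ℂ H) {x y : H} (h : ∀ i, b.repr x i = b.repr y i) :
    x = y :=
  b.repr.injective (lp.ext (funext h))

/-- The bounded diagonal operator with given bounded coefficients. -/
lemma exists_diagonal_clm (b : HilbertBasis ι ℂ H) {c : ι → ℂ} {C : ℝ} (hC : ∀ i, ‖c i‖ ≤ C) :
    ∃ D : H →L[ℂ] H, ∀ x i, b.repr (D x) i = c i * b.repr x i := by
  have hbound : ∀ (x : L2 ι) (s : Finset ι),
      ∑ i ∈ s, ‖c i * x i‖ ^ (2 : ENNReal).toReal ≤ (|C| * ‖x‖) ^ (2 : ENNReal).toReal := by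
    intro x s
    have h2 : (0 : ℝ) < (2 : ENNReal).toReal := by norm_num
    rw [Real.mul_rpow (abs_nonneg _) (norm_nonneg _)]
    refine le_trans ?_ (mul_le_mul_of_nonneg_left (lp.sum_rpow_le_norm_rpow h2 x s)
      (Real.rpow_nonneg (abs_nonneg C) _))
    rw [Finset.mul_sum]
    refine Finset.sum_le_sum fun i _ => ?_
    rw [← Real.mul_rpow (abs_nonneg _) (norm_nonneg _), norm_mul]
    refine Real.rpow_le_rpow (by positivity) ?_ h2.le
    exact mul_le_mul_of_nonneg_right ((hC i).trans (le_abs_self C)) (norm_nonneg _)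
  let D₀ : L2 ι →ₗ[ℂ] L2 ι :=
    { toFun := fun x => ⟨fun i => c i * x i, memℓp_gen' (hbound x)⟩
      map_add' := fun x y => lp.ext (funext fun i => mul_add (c i) (x i) (y i))
      map_smul' := fun a x => lp.ext (funext fun i => mul_left_comm (c i) a (x i)) }
  let D : L2 ι →L[ℂ] L2 ι := D₀.mkContinuous |C| fun x =>
    lp.norm_le_of_forall_sum_le (by norm_num) (by positivity) (hbound x)
  refine ⟨(b.repr.symm.toContinuousLinearEquiv : L2 ι →L[ℂ] H) ∘L D ∘L
    (b.repr.toContinuousLinearEquiv : H →L[ℂ] L2 ι), fun x i => ?_⟩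
  change b.repr (b.repr.symm (D (b.repr x))) i = _
  rw [LinearIsometryEquiv.apply_symm_apply]
  rfl

variable {T : H →ₗ.[ℂ] H} {b : HilbertBasis ι ℂ H} {lam : ι → ℝ}

lemma IsDiagonal.repr_apply (h : IsDiagonal T b lam) (x : T.domain) (i : ι) :
    b.repr (T x) i = (lam i : ℂ) * b.repr x i :=
  (h _ _).1 (T.mem_graph x) i

lemma IsDiagonal.mem_eigenspaceOf (h : IsDiagonal T b lam) {z : ℂ} {x : T.domain} :
    x ∈ eigenspaceOf T z ↔ ∀ i, (lam i : ℂ) ≠ z → b.repr x i = 0 := by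
  have h1 : x ∈ eigenspaceOf T z ↔ T x = z • (x : H) := by
    rw [eigenspaceOf, LinearMap.mem_ker, LinearMap.sub_apply, sub_eq_zero]
    rfl
  rw [h1]
  constructor
  · intro hx i hi
    have h2 := h.repr_apply x i
    rw [hx, map_smul, lp.coeFn_smul, Pi.smul_apply, smul_eq_mul, ← sub_eq_zero, ← sub_mul,
      mul_eq_zero, sub_eq_zero] at h2
    exact h2.resolve_left fun h3 => hi h3.symm
  · intro hx
    refine hilbertBasis_ext b fun i => ?_
    rw [h.repr_apply, map_smul, lp.coeFn_smul, Pi.smul_apply, smul_eq_mul]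
    by_cases hi : (lam i : ℂ) = z
    · rw [hi]
    · rw [hx i hi, mul_zero, mul_zero]

lemma IsDiagonal.mem_resolventSet (h : IsDiagonal T b lam) (hfin : ∀ c, {i | lam i ≤ c}.Finite)
    {z : ℂ} (hz : ∀ i, (lam i : ℂ) ≠ z) : z ∈ resolventSet T := by
  obtain ⟨d, hd, hdist⟩ := exists_pos_le_norm_sub hfin z
  obtain ⟨D, hD⟩ := exists_diagonal_clm b (c := fun i => ((lam i : ℂ) - z)⁻¹) (C := d⁻¹)
    fun i => by
      rw [norm_inv]
      exact inv_anti₀ hd (hdist i (hz i))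
  have hne (i : ι) : (lam i : ℂ) - z ≠ 0 := sub_ne_zero.2 (hz i)
  refine ⟨D, fun y => ?_, fun x => ?_⟩
  · have hg : (D y, y + z • D y) ∈ T.graph := by
      rw [h]
      intro i
      rw [map_add, map_smul, lp.coeFn_add, lp.coeFn_smul, Pi.add_apply, Pi.smul_apply, smul_eq_mul,
        hD]
      field_simp [hne i]
      ring
    have hdom := LinearPMap.mem_domain_of_mem_graph hg
    refine ⟨hdom, ?_⟩
    rw [← (LinearPMap.image_iff hdom).2 hg, add_sub_cancel_right]
  · refine hilbertBasis_ext b fun i => ?_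
    rw [hD, map_sub, map_smul, lp.coeFn_sub, lp.coeFn_smul, Pi.sub_apply, Pi.smul_apply,
      smul_eq_mul, h.repr_apply, ← sub_mul, inv_mul_cancel_left₀ (hne i)]

/-- The eigenspace for `z` of a diagonal operator is spanned by the basis vectors `b i` with
`lam i = z`; the isomorphism reads off their coefficients. -/
lemma IsDiagonal.nonempty_eigenspaceOf_equiv (h : IsDiagonal T b lam) {z : ℂ}
    (hz : {i | (lam i : ℂ) = z}.Finite) :
    Nonempty (eigenspaceOf T z ≃ₗ[ℂ] ({i | (lam i : ℂ) = z} → ℂ)) := by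
  classical
  have : Fintype {i | (lam i : ℂ) = z} := hz.fintype
  let Φ : eigenspaceOf T z →ₗ[ℂ] ({i | (lam i : ℂ) = z} → ℂ) :=
    { toFun := fun x i => b.repr (x : T.domain) i
      map_add' := fun x y => by
        funext i
        simp
      map_smul' := fun c x => by
        funext i
        simp }
  refine ⟨LinearEquiv.ofBijective Φ ⟨?_, ?_⟩⟩
  · rw [← LinearMap.ker_eq_bot, LinearMap.ker_eq_bot']
    intro x hx
    refine Subtype.ext (Subtype.ext (hilbertBasis_ext b fun i => ?_))
    have h0 : b.repr (x : T.domain) i = 0 := by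
      by_cases hi : (lam i : ℂ) = z
      · exact congrFun hx ⟨i, hi⟩
      · exact h.mem_eigenspaceOf.1 x.2 i hi
    rw [h0]
    simp
  · intro c
    let x : H := ∑ i : {i | (lam i : ℂ) = z}, c i • b i
    have hx (i : ι) : b.repr x i = ∑ j : {i | (lam i : ℂ) = z}, if i = j then c j else 0 := by
      simp only [x, map_sum, map_smul, b.repr_self, lp.coeFn_sum, Finset.sum_apply, lp.coeFn_smul,
        Pi.smul_apply, lp.single_apply, Pi.single_apply, smul_eq_mul, mul_ite, mul_one, mul_zero]
    have hx0 (i : ι) (hi : (lam i : ℂ) ≠ z) : b.repr x i = 0 := by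
      rw [hx]
      refine Finset.sum_eq_zero fun j _ => if_neg ?_
      rintro rfl
      exact hi j.2
    have hg : (x, z • x) ∈ T.graph := by
      rw [h]
      intro i
      rw [map_smul, lp.coeFn_smul, Pi.smul_apply, smul_eq_mul]
      by_cases hi : (lam i : ℂ) = z
      · rw [hi]
      · rw [hx0 i hi, mul_zero, mul_zero]
    have hdom := LinearPMap.mem_domain_of_mem_graph hg
    refine ⟨⟨⟨x, hdom⟩, h.mem_eigenspaceOf.2 hx0⟩, funext fun i => ?_⟩
    change b.repr x i = c i
    rw [hx, Finset.sum_eq_single i (fun j _ hj => if_neg fun hij => hj (Subtype.ext hij.symm))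
      (fun hi => absurd (Finset.mem_univ i) hi), if_pos rfl]

lemma finite_setOf_eq (hfin : ∀ c, {i | lam i ≤ c}.Finite) (z : ℂ) :
    {i | (lam i : ℂ) = z}.Finite := by
  refine (hfin z.re).subset fun i hi => ?_
  have : (lam i : ℂ) = z := hi
  rw [Set.mem_ofPred_eq, ← this, Complex.ofReal_re]

lemma IsDiagonal.toENat_rank (h : IsDiagonal T b lam) (hfin : ∀ c, {i | lam i ≤ c}.Finite)
    (μ : ℝ) : Cardinal.toENat (Module.rank ℂ (eigenspaceOf T (μ : ℂ))) =
      {i | lam i = μ}.encard := by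
  classical
  have hz := finite_setOf_eq hfin (μ : ℂ)
  obtain ⟨Φ⟩ := h.nonempty_eigenspaceOf_equiv hz
  have : Fintype {i | (lam i : ℂ) = (μ : ℂ)} := hz.fintype
  have he : {i | lam i = μ} = {i | (lam i : ℂ) = (μ : ℂ)} := by
    ext i
    simp
  have : FiniteDimensional ℂ (eigenspaceOf T (μ : ℂ)) := Φ.symm.finiteDimensional
  rw [← Module.finrank_eq_rank, Φ.finrank_eq, Module.finrank_fintype_fun_eq_card, he,
    map_natCast, Set.encard, ENat.card_eq_coe_fintype_card]

lemma IsDiagonal.hasPurelyDiscreteSpectrum (h : IsDiagonal T b lam)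
    (hfin : ∀ c, {i | lam i ≤ c}.Finite) : HasPurelyDiscreteSpectrum T := by
  rw [HasPurelyDiscreteSpectrum, essSpectrum, Set.sdiff_eq_empty]
  have hex : ∀ z ∈ spectrumOf T, ∃ i, (lam i : ℂ) = z := by
    intro z hz
    by_contra! hne
    exact hz (h.mem_resolventSet hfin hne)
  intro z hz
  obtain ⟨i, hi⟩ := hex z hz
  have hfz := finite_setOf_eq hfin z
  obtain ⟨Φ⟩ := h.nonempty_eigenspaceOf_equiv hfz
  have : Finite {i | (lam i : ℂ) = z} := hfz
  refine ⟨hz, ?_, ?_, ?_⟩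
  · obtain ⟨d, hd, hdist⟩ := exists_pos_le_norm_sub hfin z
    refine ⟨d, hd, fun w hw hwz => ?_⟩
    obtain ⟨j, rfl⟩ := hex w hw
    by_contra hne
    rw [dist_eq_norm] at hwz
    exact absurd (hdist j hne) (not_le.2 hwz)
  · intro hbot
    have : Subsingleton (eigenspaceOf T z) := by
      rw [hbot]
      infer_instance
    have hs : Subsingleton ({i | (lam i : ℂ) = z} → ℂ) := Φ.symm.toEquiv.subsingleton
    have := congrFun (hs.elim (fun _ => 0) (fun _ => 1)) ⟨i, hi⟩
    exact zero_ne_one this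
  · exact Φ.symm.finiteDimensional

lemma IsDiagonal.belowEssSpectrum (h : IsDiagonal T b lam)
    (hfin : ∀ c, {i | lam i ≤ c}.Finite) (μ : ℝ) : BelowEssSpectrum T μ := by
  intro z hz
  have he : essSpectrum T = ∅ := h.hasPurelyDiscreteSpectrum hfin
  rw [he] at hz
  exact hz.elim

lemma IsDiagonal.isEigenvalueSequence_iff (h : IsDiagonal T b lam)
    (hfin : ∀ c, {i | lam i ≤ c}.Finite) {s : ℕ → ℝ} : IsEigenvalueSequence T s ↔
      Monotone s ∧ ∃ e : ℕ ≃ ι, ∀ n, s n = lam (e n) := by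
  constructor
  · rintro ⟨hm, -, hcount⟩
    refine ⟨hm, ?_⟩
    have hfib : ∀ μ : ℝ, Nonempty ({n // s n = μ} ≃ {i // lam i = μ}) := by
      intro μ
      have h1 := hcount μ (h.belowEssSpectrum hfin μ)
      rw [h.toENat_rank hfin] at h1
      have h2 : {i | lam i = μ}.Finite := (hfin μ).subset fun i hi => le_of_eq hi
      have h3 : {n | s n = μ}.Finite := by
        rw [← Set.encard_lt_top_iff, h1]
        exact h2.encard_lt_top
      have : Finite {n // s n = μ} := h3
      have : Finite {i // lam i = μ} := h2
      refine Finite.card_eq.1 ?_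
      exact congrArg ENat.toNat h1
    let Ψ := fun μ => (hfib μ).some
    refine ⟨(Equiv.sigmaFiberEquiv s).symm.trans
      ((Equiv.sigmaCongrRight fun μ => (Ψ μ)).trans (Equiv.sigmaFiberEquiv lam)), fun n => ?_⟩
    exact ((Ψ (s n)) ⟨n, rfl⟩).2.symm
  · rintro ⟨hm, e, he⟩
    refine ⟨hm, fun n => h.belowEssSpectrum hfin _, fun μ _ => ?_⟩
    rw [h.toENat_rank hfin]
    have : {n | s n = μ} = e ⁻¹' {i | lam i = μ} := by
      ext n
      simp [he]
    rw [this]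
    exact Set.encard_preimage_of_bijective e.bijective _

lemma IsDiagonal.exists_isEigenvalueSequence [Infinite ι] (h : IsDiagonal T b lam)
    (hfin : ∀ c, {i | lam i ≤ c}.Finite) : ∃ s, IsEigenvalueSequence T s := by
  obtain ⟨e, he⟩ := exists_equiv_monotone hfin
  exact ⟨_, (h.isEigenvalueSequence_iff hfin).2 ⟨he, e, fun n => rfl⟩⟩

lemma IsDiagonal.hasSum_form (h : IsDiagonal T b lam) {x y : H} (hxy : (x, y) ∈ T.graph) :
    HasSum (fun i => lam i * ‖b.repr x i‖ ^ 2) (⟪x, y⟫_ℂ).re := by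
  have h1 := (b.hasSum_inner_mul_inner x y).mapL Complex.reCLM
  have h2 (i : ι) : Complex.reCLM (⟪x, b i⟫_ℂ * ⟪b i, y⟫_ℂ) = lam i * ‖b.repr x i‖ ^ 2 := by
    rw [← b.repr_apply_apply y, (h x y).1 hxy, ← inner_conj_symm, ← b.repr_apply_apply x,
      mul_left_comm, ← Complex.normSq_eq_conj_mul_self, ← Complex.ofReal_mul, Complex.reCLM_apply,
      Complex.ofReal_re, Complex.normSq_eq_norm_sq]
  simp_rw [h2] at h1
  exact h1

lemma hasSum_norm_sq (b : HilbertBasis ι ℂ H) (x : H) :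
    HasSum (fun i => ‖b.repr x i‖ ^ 2) (‖x‖ ^ 2) := by
  have h1 := (b.hasSum_inner_mul_inner x x).mapL Complex.reCLM
  have h2 (i : ι) : Complex.reCLM (⟪x, b i⟫_ℂ * ⟪b i, x⟫_ℂ) = ‖b.repr x i‖ ^ 2 := by
    rw [← inner_conj_symm, ← b.repr_apply_apply x, ← Complex.normSq_eq_conj_mul_self,
      Complex.reCLM_apply, Complex.ofReal_re, Complex.normSq_eq_norm_sq]
  have h3 : Complex.reCLM ⟪x, x⟫_ℂ = ‖x‖ ^ 2 := inner_self_eq_norm_sq (𝕜 := ℂ) x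
  simp_rw [h2, h3] at h1
  exact h1

/-- The standard basis diagonalizes multiplication operators. -/
lemma isDiagonal_mulOperator {V : Type*} (g : V → ℝ) :
    IsDiagonal (mulOperator g) (HilbertBasis.ofRepr (LinearIsometryEquiv.refl ℂ (L2 V))) g :=
  fun _ _ => mem_graph_mulOperator

end Diagonal

/-! ### Compact resolvents -/

section CompactResolvent

open scoped InnerProductSpace
open Filter Topology

universe u

variable {H : Type u} [NormedAddCommGroup H] [InnerProductSpace ℂ H] [CompleteSpace H]

/-- An orthonormal family tends weakly to zero, so a compact operator maps it to a null family. -/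
lemma finite_setOf_le_norm_apply {ι : Type*} {K : H →L[ℂ] H} (hK : IsCompactOperator K)
    {e : ι → H} (he : Orthonormal ℂ e) {δ : ℝ} (hδ : 0 < δ) : {i | δ ≤ ‖K (e i)‖}.Finite := by
  by_contra hinf
  have hne : (cofinite ⊓ 𝓟 {i | δ ≤ ‖K (e i)‖}).NeBot :=
    cofinite_inf_principal_neBot_iff.2 hinf
  let U : Ultrafilter ι := Ultrafilter.of (cofinite ⊓ 𝓟 {i | δ ≤ ‖K (e i)‖})
  have hU : (U : Filter ι) ≤ cofinite ⊓ 𝓟 {i | δ ≤ ‖K (e i)‖} := Ultrafilter.of_le _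
  obtain ⟨C, hC, hsub⟩ := hK.image_closedBall_subset_compact (f := (K : H →ₗ[ℂ] H)) 1
  have hmem : ∀ i, K (e i) ∈ C := fun i =>
    hsub ⟨e i, by rw [mem_closedBall_zero_iff, he.1 i], rfl⟩
  obtain ⟨y, -, hy⟩ := hC.ultrafilter_le_nhds (U.map fun i => K (e i))
    (le_principal_iff.2 (Ultrafilter.mem_map.2 (univ_mem' hmem)))
  have hlim : Tendsto (fun i => K (e i)) U (𝓝 y) := hy
  have h1 : Tendsto (fun i => ⟪K (e i), y⟫_ℂ) U (𝓝 ⟪y, y⟫_ℂ) := hlim.inner tendsto_const_nhds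
  have h2 : Tendsto (fun i => ⟪K (e i), y⟫_ℂ) U (𝓝 0) := by
    have h3 := (he.inner_products_summable (ContinuousLinearMap.adjoint K y)).tendsto_cofinite_zero
    have h4 : Tendsto (fun i => ‖⟪e i, ContinuousLinearMap.adjoint K y⟫_ℂ‖) cofinite (𝓝 0) := by
      have := h3.sqrt
      simpa using this
    refine tendsto_zero_iff_norm_tendsto_zero.2 ?_
    simp_rw [← ContinuousLinearMap.adjoint_inner_right]
    exact h4.mono_left (hU.trans inf_le_left)
  have hy0 : y = 0 := inner_self_eq_zero.1 (tendsto_nhds_unique h1 h2)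
  have h5 : δ ≤ ‖y‖ := ge_of_tendsto hlim.norm
    ((le_principal_iff.1 (hU.trans inf_le_right)))
  rw [hy0, norm_zero] at h5
  exact absurd hδ (not_lt.2 h5)

variable {T : H →ₗ.[ℂ] H} {R : H →L[ℂ] H}

/-- An operator with compact resolvent is diagonalizable, with eigenvalues tending to infinity. -/
lemma IsNegOneResolvent.exists_isDiagonal (h : IsNegOneResolvent T R)
    (hR : IsCompactOperator R) :
    ∃ (ι : Type u) (b : HilbertBasis ι ℂ H) (lam : ι → ℝ), IsDiagonal T b lam ∧
      ∀ c, {i | lam i ≤ c}.Finite := by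
  have hsymm : (R : H →ₗ[ℂ] H).IsSymmetric := h.symm
  let E : ℂ → Submodule ℂ H := Module.End.eigenspace (R : Module.End ℂ H)
  have hcomp (μ : ℂ) : CompleteSpace (E μ) := by
    have : IsClosed (E μ : Set H) := by
      have : (E μ : Set H) = {x | R x = μ • x} := by
        ext x
        exact Module.End.mem_eigenspace_iff
      rw [this]
      exact isClosed_eq R.continuous (continuous_const_smul μ)
    exact this.completeSpace_coe
  choose w B hB using fun μ => exists_hilbertBasis ℂ (E μ)
  have horth : Orthonormal ℂ fun a : (Σ μ, w μ) => ((B a.1 a.2 : E a.1) : H) :=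
    hsymm.orthogonalFamily_eigenspaces.orthonormal_sigma_orthonormal
      (v_family := fun μ => B μ) fun μ => (B μ).orthonormal
  have htop : (Submodule.span ℂ (Set.range fun a : (Σ μ, w μ) => ((B a.1 a.2 : E a.1) : H)))ᗮ = ⊥ := by
    have hall := ContinuousLinearMap.orthogonalComplement_iSup_eigenspaces_eq_bot hR hsymm
    rw [eq_bot_iff, ← hall, ← Submodule.iInf_orthogonal]
    refine fun x hx => (Submodule.mem_iInf _).2 fun μ z hz => ?_
    have h1 := ((B μ).hasSum_repr ⟨z, hz⟩).mapL (innerSL ℂ x ∘L (E μ).subtypeL)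
    have h2 (j : w μ) : (innerSL ℂ x ∘L (E μ).subtypeL) ((B μ).repr ⟨z, hz⟩ j • B μ j) = 0 := by
      rw [map_smul]
      have h3 := hx _ (Submodule.subset_span ⟨⟨μ, j⟩, rfl⟩)
      have h4 : (innerSL ℂ x ∘L (E μ).subtypeL) (B μ j) = 0 := inner_eq_zero_symm.1 h3
      rw [h4, smul_zero]
    simp_rw [h2] at h1
    exact inner_eq_zero_symm.1 (h1.unique hasSum_zero)
  let b : HilbertBasis (Σ μ, w μ) ℂ H := HilbertBasis.mkOfOrthogonalEqBot horth htop
  have hb (a : Σ μ, w μ) : R (b a) = a.1 • b a := by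
    have : b a = ((B a.1 a.2 : E a.1) : H) := by
      rw [HilbertBasis.coe_mkOfOrthogonalEqBot]
    rw [this]
    exact Module.End.mem_eigenspace_iff.1 (B a.1 a.2).2
  have hba (a : Σ μ, w μ) : ⟪b a, b a⟫_ℂ = 1 := by
    rw [inner_self_eq_norm_sq_to_K, b.orthonormal.1 a]
    norm_num
  let m : (Σ μ, w μ) → ℝ := fun a => a.1.re
  have hm (a : Σ μ, w μ) : a.1 = (m a : ℂ) := by
    have h1 := h.symm (b a) (b a)
    rw [hb, inner_smul_left, inner_smul_right, hba, mul_one, mul_one] at h1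
    exact (Complex.conj_eq_iff_re.1 h1).symm
  have hbm (a : Σ μ, w μ) : R (b a) = (m a : ℂ) • b a := by rw [← hm, hb]
  have hpos (a : Σ μ, w μ) : 0 < m a := by
    have h1 := h.nonneg (b a)
    rw [hbm, inner_smul_right, hba, mul_one, Complex.ofReal_re] at h1
    refine lt_of_le_of_ne h1 fun h0 => ?_
    have h2 := h.injective (x := b a) (by rw [hbm, ← h0, Complex.ofReal_zero, zero_smul])
    have h3 := b.orthonormal.1 a
    rw [h2, norm_zero] at h3
    exact zero_ne_one h3
  have hrepr (x : H) (a : Σ μ, w μ) : b.repr (R x) a = (m a : ℂ) * b.repr x a := by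
    rw [b.repr_apply_apply, b.repr_apply_apply, ← h.symm, hbm, inner_smul_left,
      Complex.conj_ofReal]
  refine ⟨_, b, fun a => (m a)⁻¹ - 1, fun x y => ?_, fun c => ?_⟩
  · rw [h.mem_graph]
    have h1 : R (x + y) = x ↔ ∀ a, b.repr (R (x + y)) a = b.repr x a :=
      ⟨fun h1 a => by rw [h1], hilbertBasis_ext b⟩
    rw [h1]
    refine forall_congr' fun a => ?_
    have hne : (m a : ℂ) ≠ 0 := Complex.ofReal_ne_zero.2 (hpos a).ne'
    rw [hrepr, map_add, lp.coeFn_add, Pi.add_apply]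
    push_cast
    constructor
    · intro h2
      field_simp
      linear_combination h2
    · intro h2
      rw [h2]
      field_simp
      ring
  · have hδ : 0 < (|c| + 1)⁻¹ := by positivity
    refine (finite_setOf_le_norm_apply hR b.orthonormal hδ).subset fun a ha => ?_
    have ha' : (m a)⁻¹ - 1 ≤ c := ha
    rw [Set.mem_ofPred_eq, hbm, norm_smul, b.orthonormal.1 a, mul_one, Complex.norm_real,
      Real.norm_of_nonneg (hpos a).le]
    refine inv_le_of_inv_le₀ (hpos a) ?_
    linarith [le_abs_self c]

omit [CompleteSpace H] in
lemma IsNegOneResolvent.mem_spectrumOf (h : IsNegOneResolvent T R) {μ : ℝ} (hμ : 0 < μ)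
    (hspec : μ ∈ spectrum ℝ R) : ((μ⁻¹ - 1 : ℝ) : ℂ) ∈ spectrumOf T := by
  rintro ⟨Z, hZ1, hZ2⟩
  refine hspec ?_
  have hne : (μ : ℂ) ≠ 0 := Complex.ofReal_ne_zero.2 hμ.ne'
  set z : ℂ := ((μ⁻¹ - 1 : ℝ) : ℂ) with hz
  have hz1 : z + 1 = (μ : ℂ)⁻¹ := by
    rw [hz]
    push_cast
    ring
  -- The two resolvents satisfy `R (1 + (z + 1) Z) = Z = (1 + (z + 1) Z) R`.
  have h1 (y : H) : R (y + (μ : ℂ)⁻¹ • Z y) = Z y := by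
    obtain ⟨hd, he⟩ := hZ1 y
    have hg : (Z y, y + z • Z y) ∈ T.graph := by
      have := T.mem_graph ⟨Z y, hd⟩
      rwa [sub_eq_iff_eq_add.1 he] at this
    have h2 := (h.mem_graph _ _).1 hg
    rw [← hz1, add_smul, one_smul, ← add_assoc, add_comm _ (Z y)]
    exact h2
  have h2 (y : H) : Z (y - (μ : ℂ)⁻¹ • R y) = R y := by
    have hg := h.apply_mem_graph y
    have hd := LinearPMap.mem_domain_of_mem_graph hg
    have h3 := hZ2 ⟨R y, hd⟩
    rw [← (LinearPMap.image_iff hd).2 hg] at h3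
    rw [← hz1, add_smul, one_smul, add_comm, ← sub_sub]
    exact h3
  have hR (y : H) : (algebraMap ℝ (H →L[ℂ] H) μ - R) y = (μ : ℂ) • y - R y := by
    rw [Algebra.algebraMap_eq_smul_one, sub_apply]
    simp
  let W : H →L[ℂ] H := (μ : ℂ)⁻¹ • (1 + (μ : ℂ)⁻¹ • Z)
  have hW (y : H) : W y = (μ : ℂ)⁻¹ • (y + (μ : ℂ)⁻¹ • Z y) := rfl
  refine ⟨⟨algebraMap ℝ (H →L[ℂ] H) μ - R, W, ?_, ?_⟩, rfl⟩
  · ext y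
    change (algebraMap ℝ (H →L[ℂ] H) μ - R) (W y) = y
    rw [hR, hW, map_smul, h1, smul_smul, mul_inv_cancel₀ hne, one_smul, add_sub_cancel_right]
  · ext y
    change W ((algebraMap ℝ (H →L[ℂ] H) μ - R) y) = y
    have h3 : (μ : ℂ) • y - R y = (μ : ℂ) • (y - (μ : ℂ)⁻¹ • R y) := by
      rw [smul_sub, smul_smul, mul_inv_cancel₀ hne, one_smul]
    rw [hR, h3, map_smul, hW, smul_smul, mul_inv_cancel₀ hne, one_smul, h2, sub_add_cancel]

omit [CompleteSpace H] in
lemma IsNegOneResolvent.finiteDimensional_ker (h : IsNegOneResolvent T R) {μ : ℝ} (hμ : 0 < μ)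
    (hfd : FiniteDimensional ℂ (eigenspaceOf T ((μ⁻¹ - 1 : ℝ) : ℂ))) :
    FiniteDimensional ℂ (LinearMap.ker ((R : H →ₗ[ℂ] H) - (μ : ℂ) • LinearMap.id)) := by
  have hne : (μ : ℂ) ≠ 0 := Complex.ofReal_ne_zero.2 hμ.ne'
  have hle : LinearMap.ker ((R : H →ₗ[ℂ] H) - (μ : ℂ) • LinearMap.id) ≤
      (eigenspaceOf T ((μ⁻¹ - 1 : ℝ) : ℂ)).map T.domain.subtype := by
    intro x hx
    have hx' : R x = (μ : ℂ) • x := by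
      rw [LinearMap.mem_ker, LinearMap.sub_apply, sub_eq_zero] at hx
      exact hx
    have hg : (x, ((μ⁻¹ - 1 : ℝ) : ℂ) • x) ∈ T.graph := by
      rw [h.mem_graph, map_add, map_smul, hx', smul_smul, ← add_smul]
      have : (μ : ℂ) + ((μ⁻¹ - 1 : ℝ) : ℂ) * μ = 1 := by
        push_cast
        field_simp
        ring
      rw [this, one_smul]
    have hd := LinearPMap.mem_domain_of_mem_graph hg
    refine ⟨⟨x, hd⟩, ?_, rfl⟩
    rw [SetLike.mem_coe, eigenspaceOf, LinearMap.mem_ker, LinearMap.sub_apply, sub_eq_zero]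
    exact ((LinearPMap.image_iff hd).2 hg).symm
  exact Submodule.finiteDimensional_of_le hle

/-- A function of `R` that is supported on finitely many eigenvalues of finite multiplicity has
finite rank: multiplying it by `x - μ` removes one of these eigenvalues. -/
lemma finiteDimensional_range_cfc (hR : IsSelfAdjoint R) (F : Finset ℝ)
    (hF : ∀ μ ∈ F, FiniteDimensional ℂ
      (LinearMap.ker ((R : H →ₗ[ℂ] H) - (μ : ℂ) • LinearMap.id))) :
    ∀ f : ℝ → ℝ, Continuous f → (∀ x ∈ spectrum ℝ R, x ∉ F → f x = 0) →
      FiniteDimensional ℂ (LinearMap.range (cfc f R : H →L[ℂ] H).toLinearMap) := by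
  classical
  induction F using Finset.induction_on with
  | empty =>
    intro f _ h0
    have : cfc f R = 0 := by
      rw [← cfc_const_zero ℝ R]
      exact cfc_congr fun x hx => h0 x hx (Finset.notMem_empty x)
    rw [this]
    change FiniteDimensional ℂ (LinearMap.range (0 : H →ₗ[ℂ] H))
    rw [LinearMap.range_zero]
    infer_instance
  | insert μ F _ ih =>
    intro f hf h0
    have h1 := ih (fun ν hν => hF ν (Finset.mem_insert_of_mem hν)) (fun x => (x - μ) * f x)
      (by fun_prop) fun x hx hxF => by
        by_cases hxμ : x = μ
        · rw [hxμ, sub_self, zero_mul]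
        · rw [h0 x hx (by simp [hxμ, hxF]), mul_zero]
    have h2 : (cfc (fun x => (x - μ) * f x) R : H →L[ℂ] H).toLinearMap =
        ((R : H →ₗ[ℂ] H) - (μ : ℂ) • LinearMap.id) ∘ₗ (cfc f R : H →L[ℂ] H).toLinearMap := by
      have h3 : (cfc (fun x : ℝ => x - μ) R : H →L[ℂ] H) = R - algebraMap ℝ _ μ := by
        rw [cfc_sub (fun x : ℝ => x) (fun _ => μ) R, cfc_id' ℝ R, cfc_const μ R]
      rw [cfc_mul (fun x => x - μ) f R (by fun_prop) (by fun_prop), h3]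
      ext x
      simp [Algebra.algebraMap_eq_smul_one]
    rw [h2, LinearMap.range_comp] at h1
    have hk := hF μ (Finset.mem_insert_self μ F)
    rw [← Submodule.fg_iff_finiteDimensional] at h1 hk ⊢
    exact Submodule.fg_of_fg_map_of_fg_inf_ker _ h1 (Submodule.FG.of_le hk inf_le_right)

omit [CompleteSpace H] in
lemma isCompactOperator_of_finiteDimensional_range {K : H →L[ℂ] H}
    (hK : FiniteDimensional ℂ (LinearMap.range K.toLinearMap)) : IsCompactOperator K := by
  have : ProperSpace (LinearMap.range K.toLinearMap) := FiniteDimensional.proper ℂ _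
  let K' : H →L[ℂ] LinearMap.range K.toLinearMap :=
    K.codRestrict (LinearMap.range K.toLinearMap) fun x => ⟨x, rfl⟩
  have h1 : IsCompactOperator K' := isCompactOperator_of_locallyCompactSpace_dom K'
  exact h1.clm_comp (LinearMap.range K.toLinearMap).subtypeL

lemma IsNegOneResolvent.finite_spectrum_inter (h : IsNegOneResolvent T R)
    (hT : HasPurelyDiscreteSpectrum T) {δ : ℝ} (hδ : 0 < δ) :
    (spectrum ℝ R ∩ Set.Ici δ).Finite := by
  by_contra hinf
  have hcpt : IsCompact (spectrum ℝ R ∩ Set.Ici δ) :=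
    (spectrum.isCompact R).inter_right isClosed_Ici
  obtain ⟨μ, hμ, hacc⟩ := Set.Infinite.exists_accPt_of_subset_isCompact hinf hcpt subset_rfl
  have hμ0 : 0 < μ := hδ.trans_le hμ.2
  have hspec := h.mem_spectrumOf hμ0 hμ.1
  obtain ⟨-, ⟨r, hr, hiso⟩, -⟩ : ((μ⁻¹ - 1 : ℝ) : ℂ) ∈ discreteSpectrum T := by
    by_contra hnot
    have : ((μ⁻¹ - 1 : ℝ) : ℂ) ∈ essSpectrum T := ⟨hspec, hnot⟩
    rw [hT] at this
    exact this
  have hcont : ContinuousAt (fun ν : ℝ => ((ν⁻¹ - 1 : ℝ) : ℂ)) μ :=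
    Complex.continuous_ofReal.continuousAt.comp
      ((continuousAt_inv₀ hμ0.ne').sub continuousAt_const)
  have hnear := hcont.eventually (Metric.ball_mem_nhds _ hr)
  obtain ⟨ν, ⟨hν, hνs⟩, hball⟩ := ((accPt_iff_frequently.1 hacc).and_eventually hnear).exists
  have heq := hiso _ (h.mem_spectrumOf (hδ.trans_le hνs.2) hνs.1) hball
  rw [Complex.ofReal_inj, sub_left_inj, inv_inj] at heq
  exact hν heq

/-- The truncations `max (R - δ) 0` have finite rank and converge to `R` in norm. -/
lemma IsNegOneResolvent.isCompactOperator (h : IsNegOneResolvent T R)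
    (hT : HasPurelyDiscreteSpectrum T) : IsCompactOperator R := by
  have hsa := h.isSelfAdjoint
  have hcl : IsClosed {K : H →L[ℂ] H | IsCompactOperator K} := isClosed_setOfPred_isCompactOperator
  refine hcl.closure_subset_iff.2 subset_rfl (Metric.mem_closure_iff.2 fun ε hε => ?_)
  have hδ : 0 < ε / 2 := half_pos hε
  refine ⟨cfc (fun x : ℝ => max (x - ε / 2) 0) R, ?_, ?_⟩
  · refine isCompactOperator_of_finiteDimensional_range
      (finiteDimensional_range_cfc hsa (h.finite_spectrum_inter hT hδ).toFinset (fun μ hμ => ?_)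
        _ (by fun_prop) fun x hx hxF => max_eq_right ?_)
    · rw [Set.Finite.mem_toFinset] at hμ
      have hμ0 : 0 < μ := hδ.trans_le hμ.2
      refine h.finiteDimensional_ker hμ0 ?_
      by_contra hnot
      have : ((μ⁻¹ - 1 : ℝ) : ℂ) ∈ essSpectrum T :=
        ⟨h.mem_spectrumOf hμ0 hμ.1, fun hd => hnot hd.2.2.2⟩
      rw [hT] at this
      exact this
    · rw [Set.Finite.mem_toFinset] at hxF
      by_contra! hlt
      exact hxF ⟨hx, (sub_pos.1 hlt).le⟩
  · rw [dist_eq_norm]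
    nth_rw 1 [← cfc_id' ℝ R]
    rw [← cfc_sub (fun x : ℝ => x) (fun x : ℝ => max (x - ε / 2) 0) R]
    refine (norm_cfc_le hδ.le fun x hx => ?_).trans_lt (half_lt_self hε)
    have hx0 := (h.spectrum_subset hx).1
    rw [Real.norm_eq_abs, abs_le]
    constructor
    · have : max (x - ε / 2) 0 ≤ x := max_le (by linarith) hx0
      linarith
    · linarith [le_max_left (x - ε / 2) 0]

end CompactResolvent

/-! ### Discreteness of the spectrum and comparison of eigenvalues -/

section Comparison

open scoped InnerProductSpace
open Filter Topology

/-- Homogeneous linear systems with more unknowns than equations, for the coefficients of a vector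
in the span of an orthonormal family. -/
lemma exists_sum_smul_of_orthonormal {H : Type*} [NormedAddCommGroup H] [InnerProductSpace ℂ H]
    {n : ℕ} {u : Fin (n + 1) → H} (hu : Orthonormal ℂ u) (φ : Fin n → H →ₗ[ℂ] ℂ) :
    ∃ c : Fin (n + 1) → ℂ, ∑ j, c j • u j ≠ 0 ∧ ∀ m, φ m (∑ j, c j • u j) = 0 := by
  let Φ : (Fin (n + 1) → ℂ) →ₗ[ℂ] (Fin n → ℂ) :=
    (LinearMap.pi φ) ∘ₗ Fintype.linearCombination ℂ u
  have hker : LinearMap.ker Φ ≠ ⊥ := LinearMap.ker_ne_bot_of_finrank_lt (by simp)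
  obtain ⟨c, hc, hc0⟩ := Submodule.exists_mem_ne_zero_of_ne_bot hker
  refine ⟨c, fun h0 => hc0 ?_, fun m => ?_⟩
  · exact funext fun j => Fintype.linearIndependent_iff.1 hu.linearIndependent c h0 j
  · have := congrFun (LinearMap.mem_ker.1 hc) m
    simpa [Φ, Fintype.linearCombination_apply] using this

lemma liminfAtInfinity_eq_top_iff {V : Type*} {g : V → ℝ} :
    liminfAtInfinity g = ⊤ ↔ ∀ c : ℝ, {v | g v ≤ c}.Finite := by
  rw [liminfAtInfinity, EReal.eq_top_iff_forall_lt]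
  constructor
  · intro h c
    obtain ⟨W, hW⟩ := lt_iSup_iff.1 (h c)
    refine W.finite_toSet.subset fun v hv => ?_
    by_contra hvW
    have h1 := hW.trans_le (iInf_le _ (⟨v, hvW⟩ : {x : V // x ∉ W}))
    exact absurd hv (not_le.2 (EReal.coe_lt_coe_iff.1 h1))
  · intro h c
    have h1 : ((c : ℝ) : EReal) < ((c + 1 : ℝ) : EReal) := EReal.coe_lt_coe_iff.2 (lt_add_one c)
    refine h1.trans_le (le_iSup_of_le (h (c + 1)).toFinset (le_iInf fun x => ?_))
    have hx := x.2
    rw [Set.Finite.mem_toFinset, Set.mem_ofPred_eq, not_le] at hx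
    exact EReal.coe_le_coe_iff.2 hx.le

variable {V : Type*} {G : SimpleGraph V} [G.LocallyFinite] {q : V → ℝ}

lemma norm_schrodingerDelta_le (hq : ∀ v, 0 ≤ q v) (v : V) :
    ‖schrodingerDelta G q v‖ ≤ 2 * degPlus G q v := by
  have hone (w : V) : ‖(delta w : L2 V)‖ = 1 := orthonormal_delta.1 w
  refine (norm_sub_le _ _).trans ?_
  have h1 : ‖∑ w ∈ G.neighborFinset v, (delta w : L2 V)‖ ≤ G.degree v := by
    refine (norm_sum_le _ _).trans ?_
    simp [hone]
  rw [norm_smul, hone, mul_one, Complex.norm_of_nonneg (degPlus_nonneg hq v)]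
  have : (G.degree v : ℝ) ≤ degPlus G q v := le_add_of_nonneg_right (hq v)
  linarith

/-- If `Δ + q` has compact resolvent `R`, then `deg + q` tends to infinity, as
`1 ≤ ‖R δ_v‖ ‖(Δ + q + 1) δ_v‖`. -/
lemma finite_degPlus_le_of_compact (hq : ∀ v, 0 ≤ q v) {R : L2 V →L[ℂ] L2 V}
    (hR : IsNegOneResolvent (schrodinger G q) R) (hc : IsCompactOperator R) (c : ℝ) :
    {v | degPlus G q v ≤ c}.Finite := by
  have hδ : 0 < (1 + 2 * |c|)⁻¹ := by positivity
  refine (finite_setOf_le_norm_apply hc orthonormal_delta hδ).subset fun v hv => ?_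
  have hv' : degPlus G q v ≤ c := hv
  have h1 := (hR.mem_graph _ _).1 (schrodingerDelta_mem_graph G q v)
  have h2 : ⟪R (delta v), delta v + schrodingerDelta G q v⟫_ℂ = 1 := by
    rw [hR.symm, h1, inner_delta_left, delta_apply, if_pos rfl]
  have h3 := norm_inner_le_norm (𝕜 := ℂ) (R (delta v)) (delta v + schrodingerDelta G q v)
  have h4 : ‖delta v + schrodingerDelta G q v‖ ≤ 1 + 2 * |c| := by
    refine (norm_add_le _ _).trans (add_le_add (orthonormal_delta.1 v).le ?_)
    refine (norm_schrodingerDelta_le hq v).trans ?_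
    linarith [le_abs_self c]
  rw [h2, norm_one] at h3
  rw [Set.mem_ofPred_eq, inv_le_iff_one_le_mul₀ (by positivity)]
  exact h3.trans (mul_le_mul_of_nonneg_left h4 (norm_nonneg _))

/-- If `deg + q` tends to infinity, then the form comparison makes the functions in the range of
the resolvent uniformly small off finite sets, whence the resolvent is compact. -/
lemma IsSparse.isCompactOperator_resolvent {k : ℝ} (hG : IsSparse G k) (hq : ∀ v, 0 ≤ q v)
    {R : L2 V →L[ℂ] L2 V} (hR : IsNegOneResolvent (schrodinger G q) R)
    (hfin : ∀ c, {v | degPlus G q v ≤ c}.Finite) : IsCompactOperator R := by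
  classical
  have hcl : IsClosed {K : L2 V →L[ℂ] L2 V | IsCompactOperator K} :=
    isClosed_setOfPred_isCompactOperator
  refine hcl.closure_subset_iff.2 subset_rfl (Metric.mem_closure_iff.2 fun ε hε => ?_)
  let M : ℝ := 2 * (‖R‖ * (1 + ‖R‖)) + 3 / 2 * |k| * ‖R‖ ^ 2
  have hM : 0 ≤ M := by positivity
  have hbound (u : L2 V) (F : Finset V) :
      ∑ v ∈ F, degPlus G q v * ‖R u v‖ ^ 2 ≤ M * ‖u‖ ^ 2 := by
    have h1 := hG.sum_degPlus_le hq (ε := 1 / 2) (by norm_num) (by norm_num)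
      (hR.apply_mem_graph u) F
    have h2 : (⟪R u, u - R u⟫_ℂ).re ≤ ‖R‖ * ‖u‖ * ((1 + ‖R‖) * ‖u‖) := by
      refine (Complex.re_le_norm _).trans ((norm_inner_le_norm _ _).trans ?_)
      refine mul_le_mul (R.le_opNorm u) ?_ (norm_nonneg _) (by positivity)
      refine (norm_sub_le _ _).trans ?_
      have := R.le_opNorm u
      linarith
    have h3 : k * ‖R u‖ ^ 2 ≤ |k| * (‖R‖ * ‖u‖) ^ 2 :=
      mul_le_mul (le_abs_self k) (pow_le_pow_left₀ (norm_nonneg _) (R.le_opNorm u) 2)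
        (sq_nonneg _) (abs_nonneg k)
    change _ ≤ (2 * (‖R‖ * (1 + ‖R‖)) + 3 / 2 * |k| * ‖R‖ ^ 2) * ‖u‖ ^ 2
    linarith
  let c : ℝ := M / (ε / 2) ^ 2 + 1
  have hc : 0 < c := by positivity
  let W := (hfin c).toFinset
  have hW (v : V) (hv : v ∉ W) : c < degPlus G q v := by
    by_contra! h
    exact hv ((Set.Finite.mem_toFinset _).2 h)
  let P : L2 V →L[ℂ] L2 V := ∑ v ∈ W, (innerSL ℂ (delta v)).smulRight (delta v)
  have hP (x : L2 V) (v : V) : (x - P x) v = if v ∈ W then 0 else x v := by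
    have h1 : P x = ∑ w ∈ W, x w • delta w := by
      simp [P]
    rw [h1, lp.coeFn_sub, lp.coeFn_sum, Pi.sub_apply, Finset.sum_apply]
    simp only [lp.coeFn_smul, Pi.smul_apply, delta_apply, smul_eq_mul, mul_ite, mul_one, mul_zero]
    rw [Finset.sum_ite_eq]
    split_ifs
    · rw [sub_self]
    · rw [sub_zero]
  refine ⟨P ∘L R, ?_, ?_⟩
  · have hPc : IsCompactOperator P := by
      refine isCompactOperator_of_finiteDimensional_range ?_
      have hle : LinearMap.range P.toLinearMap ≤ Submodule.span ℂ (W.image delta : Set (L2 V)) := by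
        rintro _ ⟨x, rfl⟩
        have h1 : P x = ∑ w ∈ W, x w • delta w := by
          simp [P]
        change P x ∈ _
        rw [h1]
        exact Submodule.sum_mem _ fun w hw => Submodule.smul_mem _ _
          (Submodule.subset_span (Finset.mem_image_of_mem _ hw))
      have := FiniteDimensional.span_finset ℂ (W.image (delta : V → L2 V))
      exact Submodule.finiteDimensional_of_le hle
    exact hPc.comp_clm R
  · rw [dist_eq_norm]
    refine (ContinuousLinearMap.opNorm_le_bound _ (half_pos hε).le fun u => ?_).trans_lt
      (half_lt_self hε)
    change ‖R u - P (R u)‖ ≤ _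
    refine lp.norm_le_of_forall_sum_le (by norm_num) (by positivity) fun F => ?_
    simp only [ENNReal.toReal_ofNat, Real.rpow_two]
    have h1 : c * ∑ v ∈ F, ‖(R u - P (R u)) v‖ ^ 2 ≤ ∑ v ∈ F, degPlus G q v * ‖R u v‖ ^ 2 := by
      rw [Finset.mul_sum]
      refine Finset.sum_le_sum fun v _ => ?_
      rw [hP]
      split_ifs with hv
      · have := mul_nonneg (degPlus_nonneg (G := G) hq v) (sq_nonneg ‖R u v‖)
        simpa using this
      · exact mul_le_mul_of_nonneg_right (hW v hv).le (sq_nonneg _)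
    have h2 := h1.trans (hbound u F)
    have h3 : M ≤ c * (ε / 2) ^ 2 := by
      have : c * (ε / 2) ^ 2 = M + (ε / 2) ^ 2 := by
        simp only [c]
        field_simp
      rw [this]
      exact le_add_of_nonneg_right (sq_nonneg _)
    refine le_of_mul_le_mul_left (h2.trans ?_) hc
    have := mul_le_mul_of_nonneg_right h3 (sq_nonneg ‖u‖)
    rw [mul_pow]
    linarith

variable {ι : Type*} {b : HilbertBasis ι ℂ (L2 V)} {lam : ι → ℝ}

/-- The upper bound of the min-max comparison: test `Δ + q` on the span of the `δ_v` belonging to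
the `n + 1` smallest values of `deg + q`. -/
lemma IsSparse.eigenvalue_le {k : ℝ} (hG : IsSparse G k) (hq : ∀ v, 0 ≤ q v)
    (h : IsDiagonal (schrodinger G q) b lam) {e₁ : ℕ ≃ ι} (he₁ : Monotone fun n => lam (e₁ n))
    {e₂ : ℕ ≃ V} (he₂ : Monotone fun n => degPlus G q (e₂ n)) {ε : ℝ} (h0 : 0 < ε) (h1 : ε ≤ 1)
    (n : ℕ) :
    lam (e₁ n) ≤ (1 + ε) * degPlus G q (e₂ n) + k / 2 * (1 / ε - ε) := by
  classical
  have hu : Orthonormal ℂ fun j : Fin (n + 1) => (delta (e₂ j) : L2 V) :=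
    orthonormal_delta.comp _ (e₂.injective.comp Fin.val_injective)
  obtain ⟨c, hx0, hx⟩ := exists_sum_smul_of_orthonormal hu
    fun m : Fin n => (innerSL ℂ (b (e₁ m))).toLinearMap
  set x : L2 V := ∑ j, c j • delta (e₂ j) with hxdef
  let W : Finset V := (Finset.range (n + 1)).image e₂
  have hsupp (v : V) (hv : v ∉ W) : x v = 0 := by
    rw [hxdef, lp.coeFn_sum, Finset.sum_apply]
    refine Finset.sum_eq_zero fun j _ => ?_
    rw [lp.coeFn_smul, Pi.smul_apply, delta_apply, if_neg, smul_zero]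
    rintro rfl
    exact hv (Finset.mem_image_of_mem _ (Finset.mem_range.2 j.2))
  obtain ⟨y, hy⟩ := exists_mem_finSuppGraph G q hsupp
  have hg := finSuppGraph_le G q hy
  have hupper := (abs_le.1 (hG.abs_form_sub_le hq h0 h1 hg hsupp)).2
  have hdeg : ∑ v ∈ W, degPlus G q v * ‖x v‖ ^ 2 ≤ degPlus G q (e₂ n) * ‖x‖ ^ 2 := by
    rw [norm_sq_eq_sum hsupp, Finset.mul_sum]
    refine Finset.sum_le_sum fun v hv => mul_le_mul_of_nonneg_right ?_ (sq_nonneg _)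
    obtain ⟨m, hm, rfl⟩ := Finset.mem_image.1 hv
    exact he₂ (Nat.lt_succ_iff.1 (Finset.mem_range.1 hm))
  have hlower : lam (e₁ n) * ‖x‖ ^ 2 ≤ (⟪x, y⟫_ℂ).re := by
    refine hasSum_le (fun i => ?_) ((hasSum_norm_sq b x).mul_left _) (h.hasSum_form hg)
    obtain ⟨m, rfl⟩ := e₁.surjective i
    rcases lt_or_ge m n with hm | hm
    · have : b.repr x (e₁ m) = 0 := by
        rw [b.repr_apply_apply]
        exact hx ⟨m, hm⟩
      simp [this]
    · exact mul_le_mul_of_nonneg_right (he₁ hm) (sq_nonneg _)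
  have hpos : 0 < ‖x‖ ^ 2 := by positivity
  refine le_of_mul_le_mul_right ?_ hpos
  have := mul_le_mul_of_nonneg_left hdeg (by linarith : 0 ≤ 1 + ε)
  linarith

/-- The lower bound of the min-max comparison: test `deg + q` on the span of the eigenfunctions of
`Δ + q` belonging to its `n + 1` smallest eigenvalues. -/
lemma IsSparse.le_eigenvalue {k : ℝ} (hG : IsSparse G k) (hq : ∀ v, 0 ≤ q v)
    (h : IsDiagonal (schrodinger G q) b lam) {e₁ : ℕ ≃ ι} (he₁ : Monotone fun n => lam (e₁ n))
    {e₂ : ℕ ≃ V} (he₂ : Monotone fun n => degPlus G q (e₂ n)) {ε : ℝ} (h0 : 0 < ε) (h1 : ε ≤ 1)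
    (n : ℕ) :
    (1 - ε) * degPlus G q (e₂ n) - k / 2 * (1 / ε - ε) ≤ lam (e₁ n) := by
  classical
  have hu : Orthonormal ℂ fun j : Fin (n + 1) => b (e₁ j) :=
    b.orthonormal.comp _ (e₁.injective.comp Fin.val_injective)
  obtain ⟨c, hx0, hx⟩ := exists_sum_smul_of_orthonormal hu
    fun m : Fin n => (innerSL ℂ (delta (e₂ m))).toLinearMap
  set x : L2 V := ∑ j, c j • b (e₁ j) with hxdef
  have hrepr (i : ι) (hi : n < e₁.symm i) : b.repr x i = 0 := by
    rw [hxdef, map_sum, lp.coeFn_sum, Finset.sum_apply]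
    refine Finset.sum_eq_zero fun j _ => ?_
    rw [map_smul, lp.coeFn_smul, Pi.smul_apply, b.repr_self, lp.single_apply, Pi.single_apply,
      if_neg, smul_zero]
    rintro rfl
    rw [e₁.symm_apply_apply] at hi
    exact absurd j.2 (by omega)
  have hg : (x, ∑ j : Fin (n + 1), (lam (e₁ j) : ℂ) • c j • b (e₁ j)) ∈
      (schrodinger G q).graph := by
    rw [h]
    intro i
    rw [hxdef, map_sum, map_sum, lp.coeFn_sum, lp.coeFn_sum, Finset.sum_apply, Finset.sum_apply,
      Finset.mul_sum]
    refine Finset.sum_congr rfl fun j _ => ?_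
    simp only [map_smul, lp.coeFn_smul, Pi.smul_apply, b.repr_self, lp.single_apply,
      Pi.single_apply, smul_eq_mul]
    split_ifs with hij
    · rw [hij]
    · simp
  set y := ∑ j : Fin (n + 1), (lam (e₁ j) : ℂ) • c j • b (e₁ j)
  have hupper : (⟪x, y⟫_ℂ).re ≤ lam (e₁ n) * ‖x‖ ^ 2 := by
    refine hasSum_le (fun i => ?_) (h.hasSum_form hg) ((hasSum_norm_sq b x).mul_left _)
    rcases lt_or_ge n (e₁.symm i) with hi | hi
    · simp [hrepr i hi]
    · have := he₁ hi
      simp only [e₁.apply_symm_apply] at this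
      exact mul_le_mul_of_nonneg_right this (sq_nonneg _)
  have hpart (F : Finset V) : (1 - ε) * degPlus G q (e₂ n) * ∑ v ∈ F, ‖x v‖ ^ 2 ≤
      (⟪x, y⟫_ℂ).re + k / 2 * (1 / ε - ε) * ‖x‖ ^ 2 := by
    refine le_trans ?_ (hG.sum_degPlus_le hq h0 h1 hg F)
    rw [mul_assoc]
    refine mul_le_mul_of_nonneg_left ?_ (sub_nonneg.2 h1)
    rw [Finset.mul_sum]
    refine Finset.sum_le_sum fun v _ => ?_
    obtain ⟨m, rfl⟩ := e₂.surjective v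
    rcases lt_or_ge m n with hm | hm
    · have : x (e₂ m) = 0 := by
        rw [← inner_delta_left]
        exact hx ⟨m, hm⟩
      simp [this]
    · exact mul_le_mul_of_nonneg_right (he₂ hm) (sq_nonneg _)
  have hlower : (1 - ε) * degPlus G q (e₂ n) * ‖x‖ ^ 2 ≤
      (⟪x, y⟫_ℂ).re + k / 2 * (1 / ε - ε) * ‖x‖ ^ 2 := by
    have hs : HasSum (fun v => ‖x v‖ ^ 2) (‖x‖ ^ 2) :=
      hasSum_norm_sq (HilbertBasis.ofRepr (LinearIsometryEquiv.refl ℂ (L2 V))) x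
    exact le_of_tendsto' (Tendsto.const_mul _ hs) hpart
  have hpos : 0 < ‖x‖ ^ 2 := by positivity
  refine le_of_mul_le_mul_right ?_ hpos
  linarith

lemma tendsto_div_of_forall_le {s t : ℕ → ℝ} {k : ℝ} (ht : Tendsto t atTop atTop)
    (hle : ∀ ε : ℝ, 0 < ε → ε ≤ 1 → ∀ n, s n ≤ (1 + ε) * t n + k / 2 * (1 / ε - ε))
    (hge : ∀ ε : ℝ, 0 < ε → ε ≤ 1 → ∀ n, (1 - ε) * t n - k / 2 * (1 / ε - ε) ≤ s n) :
    Tendsto (fun n => s n / t n) atTop (𝓝 1) := by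
  rw [Metric.tendsto_atTop']
  intro δ hδ
  obtain ⟨ε, h0, hε⟩ : ∃ ε : ℝ, 0 < ε ∧ ε ≤ 1 ∧ ε ≤ δ / 2 :=
    ⟨min 1 (δ / 2), lt_min one_pos (half_pos hδ), min_le_left _ _, min_le_right _ _⟩
  set C := k / 2 * (1 / ε - ε) with hC
  obtain ⟨N, hN⟩ := eventually_atTop.1 (ht.eventually_gt_atTop (max 1 (2 * |C| / δ)))
  refine ⟨N, fun n hn => ?_⟩
  have hbig := hN n hn.le
  have ht1 : 0 < t n := one_pos.trans ((le_max_left _ _).trans_lt hbig)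
  have ht2 : |C| < δ / 2 * t n := by
    have := (le_max_right _ _).trans_lt hbig
    rw [div_lt_iff₀ hδ] at this
    linarith
  have hu := hle ε h0 hε.1 n
  have hl := hge ε h0 hε.1 n
  rw [← hC] at hu hl
  have ht3 := mul_le_mul_of_nonneg_right hε.2 ht1.le
  have hcl := neg_abs_le C
  have hcu := le_abs_self C
  rw [Real.dist_eq, div_sub_one ht1.ne', abs_div, abs_of_pos ht1, div_lt_iff₀ ht1, abs_lt]
  constructor <;> linarith

end Comparison

end SparseGraph

end

open SparseGraph in
theorem theoremt {V : Type*} [Countable V] (G : SimpleGraph V) [G.LocallyFinite]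
    (k : ℝ) (hG : IsSparse G k) (q : V → ℝ) (hq : ∀ v, 0 ≤ q v) :
    (∀ ε : ℝ, 0 < ε → ε ≤ 1 → ∀ f : L2 V, (Function.support (f : V → ℂ)).Finite →
      ∃ (hΔ : f ∈ (schrodinger G q).domain) (hd : f ∈ (mulOperator (degPlus G q)).domain),
        (1 - ε) * quadForm (mulOperator (degPlus G q)) ⟨f, hd⟩ - k / 2 * (1 / ε - ε) * ‖f‖ ^ 2
            ≤ quadForm (schrodinger G q) ⟨f, hΔ⟩ ∧
        quadForm (schrodinger G q) ⟨f, hΔ⟩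
            ≤ (1 + ε) * quadForm (mulOperator (degPlus G q)) ⟨f, hd⟩
              + k / 2 * (1 / ε - ε) * ‖f‖ ^ 2) ∧
    ((∃ S, IsNonnegSqrt S (schrodinger G q)) ∧
      (∃ S, IsNonnegSqrt S (mulOperator (degPlus G q))) ∧
      ∀ S₁ S₂, IsNonnegSqrt S₁ (schrodinger G q) →
        IsNonnegSqrt S₂ (mulOperator (degPlus G q)) → S₁.domain = S₂.domain) ∧
    (HasPurelyDiscreteSpectrum (schrodinger G q) ↔ liminfAtInfinity (degPlus G q) = ⊤) ∧
    (Infinite V → HasPurelyDiscreteSpectrum (schrodinger G q) →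
      (∃ lam, IsEigenvalueSequence (schrodinger G q) lam) ∧
      (∃ lam, IsEigenvalueSequence (mulOperator (degPlus G q)) lam) ∧
      ∀ lam₁ lam₂ : ℕ → ℝ, IsEigenvalueSequence (schrodinger G q) lam₁ →
        IsEigenvalueSequence (mulOperator (degPlus G q)) lam₂ →
        Filter.Tendsto (fun n => lam₁ n / lam₂ n) Filter.atTop (nhds 1)) := by
  have hdeg := degPlus_nonneg (G := G) hq
  obtain ⟨R, hR⟩ := (hG.isGraphCore hq).exists_resolvent
  obtain ⟨Γ, hΓ, -⟩ := exists_isGraphCore_mulOperator hdeg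
  obtain ⟨R', hR'⟩ := hΓ.exists_resolvent
  have hfin (hT : HasPurelyDiscreteSpectrum (schrodinger G q)) :=
    finite_degPlus_le_of_compact hq hR (hR.isCompactOperator hT)
  refine ⟨fun ε h0 h1 f hf => ?_, ⟨hR.exists_isNonnegSqrt, hR'.exists_isNonnegSqrt,
    fun S₁ S₂ h₁ h₂ => hG.sqrt_domain_eq hq h₁ h₂⟩, ⟨fun hT => ?_, fun hlim => ?_⟩,
    fun hV hT => ?_⟩
  · have hsupp (v : V) (hv : v ∉ hf.toFinset) : f v = 0 := by
      simpa using hv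
    obtain ⟨y, hy⟩ := exists_mem_finSuppGraph G q hsupp
    obtain ⟨z, hz⟩ := mem_graph_mulOperator_of_support (g := degPlus G q) hsupp
    have hg := finSuppGraph_le G q hy
    have hdΔ := LinearPMap.mem_domain_of_mem_graph hg
    have hdd := LinearPMap.mem_domain_of_mem_graph hz
    refine ⟨hdΔ, hdd, ?_⟩
    have hb := abs_le.1 (hG.abs_form_sub_le hq h0 h1 hg hsupp)
    rw [← re_inner_mul_eq_sum hsupp (mem_graph_mulOperator.1 hz)] at hb
    rw [quadForm, quadForm, ← (LinearPMap.image_iff hdΔ).2 hg, ← (LinearPMap.image_iff hdd).2 hz]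
    constructor <;> linarith [hb.1, hb.2]
  · exact liminfAtInfinity_eq_top_iff.2 (hfin hT)
  · have hc := hG.isCompactOperator_resolvent hq hR (liminfAtInfinity_eq_top_iff.1 hlim)
    obtain ⟨ι, b, lam, hdiag, hlam⟩ := hR.exists_isDiagonal hc
    exact hdiag.hasPurelyDiscreteSpectrum hlam
  · obtain ⟨ι, b, lam, hdiag, hlam⟩ := hR.exists_isDiagonal (hR.isCompactOperator hT)
    have hdiag' := isDiagonal_mulOperator (degPlus G q)
    have hι : Infinite ι := by
      by_contra hι
      have : Finite ι := not_infinite_iff_finite.1 hι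
      have : Fintype ι := Fintype.ofFinite ι
      have : FiniteDimensional ℂ (L2 V) := b.toOrthonormalBasis.toBasis.finiteDimensional_of_finite
      have : Finite V := (orthonormal_delta (V := V)).linearIndependent.finite
      exact not_finite V
    refine ⟨hdiag.exists_isEigenvalueSequence hlam, hdiag'.exists_isEigenvalueSequence (hfin hT),
      fun lam₁ lam₂ h₁ h₂ => ?_⟩
    obtain ⟨hm₁, e₁, he₁⟩ := (hdiag.isEigenvalueSequence_iff hlam).1 h₁
    obtain ⟨hm₂, e₂, he₂⟩ := (hdiag'.isEigenvalueSequence_iff (hfin hT)).1 h₂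
    obtain rfl : lam₁ = fun n => lam (e₁ n) := funext he₁
    obtain rfl : lam₂ = fun n => degPlus G q (e₂ n) := funext he₂
    refine tendsto_div_of_forall_le (k := k) ?_
      (fun ε h0 h1 n => hG.eigenvalue_le hq hdiag hm₁ hm₂ h0 h1 n)
      (fun ε h0 h1 n => hG.le_eigenvalue hq hdiag hm₁ hm₂ h0 h1 n)
    refine Filter.tendsto_atTop.2 fun c => ?_
    have hpre : {n | degPlus G q (e₂ n) < c}.Finite :=
      ((hfin hT c).preimage e₂.injective.injOn).subset fun n (hn : _ < c) => hn.le
    rw [← Nat.cofinite_eq_atTop, Filter.eventually_cofinite]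
    simpa using hpre
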